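/- **Corollary 5.6 (delay).** Let $(\Omega,\omega)$ be a measure space and let $F:\Omega\to\Omega$ be measurable and $\omega$-preserving, with Koopman operator $\mathcal K g=g\circ F$, an isometry of $L^2(\Omega,\omega)$ (inner product linear in the first argument). For $g\in L^2(\Omega,\omega)$ with $\|g\|=1$, the spectral measure of $\mathcal K$ with respect to $g$ is the Borel probability measure $\mu_g(U)=\langle \mathcal E'(U)g,g\rangle$ on the unit circle $\mathbb T$, where $\mathcal E'$ is the projection-valued spectral measure of a unitary extension $\mathcal K'$ of $\mathcal K$ to a Hilbert space $\mathcal H'\supset L^2(\Omega,\omega)$ (it does not depend on the extension). For Borel probability measures $\mu,\nu$ on $\mathbb T$, let $W_1(\mu,\nu)=\sup\{\int_{\mathbb T}\phi\,d\mu-\int_{\mathbb T}\phi\,d\nu\}$, the supremum over all $\phi:\mathbb T\to\mathbb R$ with $|\phi(z)-\phi(z')|\le|z-z'|$. Let $\psi_1,\dots,\psi_N$ be square-integrable functions on $\Omega$ that are linearly independent in $L^2(\Omega,\omega)$, let $V_N=\mathrm{span}\{\psi_1,\dots,\psi_N\}$, $\Psi=[\psi_1\ \cdots\ \psi_N]$.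 For every $M\ge 1$ let nodes $x^{(1)},\dots,x^{(M)}\in\Omega$ and real weights $w_1,\dots,w_M$ be given (both may depend on $M$), and put $$G_{jk}=\sum_{m=1}^M w_m\,\overline{\psi_j(x^{(m)})}\,\psi_k(x^{(m)}),\qquad A_{jk}=\sum_{m=1}^M w_m\,\overline{\psi_j(x^{(m)})}\,\psi_k(F(x^{(m)})).$$ Suppose that the quadrature converges: for all $j,k$, $$\lim_{M\to\infty}G_{jk}=\langle\psi_k,\psi_j\rangle,\qquad \lim_{M\to\infty}A_{jk}=\langle\mathcal K\psi_k,\psi_j\rangle ,$$ so that $G$ is positive definite for all large $M$. For such $M$, let $G^{-1/2}A^*G^{-1/2}=U_1\Sigma U_2^*$ be any singular value decomposition and $U_2U_1^*=\hat V\,\mathrm{diag}(\lambda_1,\dots,\lambda_N)\,\hat V^*$, with $\hat V$ unitary, any eigendecomposition, and let $v_1,\dots,v_N$ be the columns of $G^{-1/2}\hat V$ (the output of mpEDMD). For $\boldsymbol g\in\mathbb C^N\setminus\{0\}$ let $\tilde{\boldsymbol g}=\boldsymbol g/(\boldsymbol g^*G\boldsymbol g)^{1/2}$ and let $$\mu_{\boldsymbol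 g}^{(N,M)}=\sum_{j=1}^N|v_j^*G\tilde{\boldsymbol g}|^2\,\delta_{\lambda_j},$$ a probability measure on $\mathbb T$. There is a universal constant $C>0$ such that, in this setting, whenever $L\ge 2$, $g=\Psi\boldsymbol g$ with $\|g\|=1$, and $g,\mathcal Kg,\dots,\mathcal K^Lg\in V_N$, $$\limsup_{M\to\infty}W_1\bigl(\mu_g,\mu_{\boldsymbol g}^{(N,M)}\bigr)\le C\,\frac{\log L}{L}.$$ If moreover the $N\times N$ matrix $(\langle\mathcal K\psi_k,\psi_j\rangle)_{j,k}$ is invertible, then $\lim_{M\to\infty}W_1(\mu_g,\mu_{\boldsymbol g}^{(N,M)})$ exists (and obeys the same bound). -/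

import Mathlib

open MeasureTheory Filter Topology
open scoped ENNReal InnerProductSpace MatrixOrder ComplexConjugate

noncomputable section

namespace MpEDMD

universe u

/-- The unit circle carries its Borel `σ`-algebra. -/
instance instMeasurableSpaceCircle : MeasurableSpace Circle := borel Circle

instance instBorelSpaceCircle : BorelSpace Circle := ⟨rfl⟩

/-! ### Projection-valued measures and spectral measures -/

/-- A projection-valued measure on the Borel sets of the unit circle `𝕋`, with values in the
orthogonal projections of the Hilbert space `H` (the values on non-Borel sets are irrelevant).
Countable additivity is in the strong operator topology. -/
structure ProjectionValuedMeasure (H : Type u) [NormedAddCommGroup H] [InnerProductSpace ℂ H]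
    [CompleteSpace H] where
  /-- the projection assigned to a set -/
  proj : Set Circle → (H →L[ℂ] H)
  isStarProjection : ∀ s, MeasurableSet s → IsStarProjection (proj s)
  proj_empty : proj ∅ = 0
  proj_univ : proj Set.univ = 1
  hasSum_iUnion : ∀ s : ℕ → Set Circle, (∀ i, MeasurableSet (s i)) →
    Pairwise (Function.onFun Disjoint s) →
      ∀ f : H, HasSum (fun i => proj (s i) f) (proj (⋃ i, s i) f)

section Scalar

variable {H : Type u} [NormedAddCommGroup H] [InnerProductSpace ℂ H] [CompleteSpace H]

theorem ProjectionValuedMeasure.re_inner_nonneg (E : ProjectionValuedMeasure H) (f : H)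
    {s : Set Circle} (hs : MeasurableSet s) : 0 ≤ (⟪f, E.proj s f⟫_ℂ).re := by
  have h := E.isStarProjection s hs
  have h1 : E.proj s f = E.proj s (E.proj s f) := by
    conv_lhs => rw [← h.isIdempotentElem.eq]
    rfl
  have h2 : ContinuousLinearMap.adjoint (E.proj s) = E.proj s := h.isSelfAdjoint
  rw [h1, ← ContinuousLinearMap.adjoint_inner_left, h2]
  exact inner_self_nonneg (𝕜 := ℂ)

/-- The positive measure `s ↦ ⟨E(s) f, f⟩` on `𝕋`. -/
def ProjectionValuedMeasure.scalarMeasure (E : ProjectionValuedMeasure H) (f : H) :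
    Measure Circle :=
  Measure.ofMeasurable (fun s _ => ENNReal.ofReal (⟪f, E.proj s f⟫_ℂ).re)
    (by simp [E.proj_empty]) (by
      intro s hs hd
      have h1 : HasSum (fun i => (⟪f, E.proj (s i) f⟫_ℂ).re)
          (⟪f, E.proj (⋃ i, s i) f⟫_ℂ).re :=
        Complex.hasSum_re ((innerSL ℂ f).hasSum (E.hasSum_iUnion s hs hd f))
      rw [← h1.tsum_eq,
        ENNReal.ofReal_tsum_of_nonneg (fun i => E.re_inner_nonneg f (hs i)) h1.summable])

/-- `E` is the spectral measure of the unitary operator `U`, that is `U = ∫ λ dE(λ)`. The integral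
is taken in the weak sense; by polarization it is enough to test it on the diagonal. -/
def ProjectionValuedMeasure.IsSpectralMeasureOf (E : ProjectionValuedMeasure H)
    (U : H ≃ₗᵢ[ℂ] H) : Prop :=
  ∀ f : H, ∫ z : Circle, (z : ℂ) ∂(E.scalarMeasure f) = ⟪f, U f⟫_ℂ

end Scalar

/-- `μ` is the spectral measure of the isometry `K` with respect to the vector `g`: there are a
unitary extension `U` of `K` to a Hilbert space `H'` that contains `H` (through the isometric
embedding `ι`), and the spectral measure `E'` of `U`, such that `μ(s) = ⟨E'(s) g, g⟩`, which is
`⟨E(s) g, g⟩` for the compression `E` of `E'` to `H`. -/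
def IsScalarSpectralMeasure {H : Type u} [NormedAddCommGroup H] [InnerProductSpace ℂ H]
    (K : H →ₗᵢ[ℂ] H) (g : H) (μ : Measure Circle) : Prop :=
  ∃ (H' : Type u) (_ : NormedAddCommGroup H') (_ : InnerProductSpace ℂ H')
    (_ : CompleteSpace H') (ι : H →ₗᵢ[ℂ] H') (U : H' ≃ₗᵢ[ℂ] H')
    (E' : ProjectionValuedMeasure H'),
    (∀ f, U (ι f) = ι (K f)) ∧ E'.IsSpectralMeasureOf U ∧ μ = E'.scalarMeasure (ι g)

/-! ### Existence of unitary extensions -/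

section Extension

variable {H : Type u} [NormedAddCommGroup H] [InnerProductSpace ℂ H]

/-- The bilateral shift `(x_n) ↦ (x_{n+a})` on `ℓ²(ℤ; H)`, as a linear map. -/
def shiftLin (H : Type u) [NormedAddCommGroup H] [InnerProductSpace ℂ H] (a : ℤ) :
    lp (fun _ : ℤ => H) 2 →ₗ[ℂ] lp (fun _ : ℤ => H) 2 where
  toFun x := ⟨fun n => x (n + a), by
    have h := lp.memℓp x
    rw [memℓp_gen_iff (by simp)] at h
    exact (memℓp_gen_iff (by simp)).mpr ((Equiv.addRight a).summable_iff.mpr h)⟩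
  map_add' x y := rfl
  map_smul' c x := rfl

theorem shiftLin_apply (a : ℤ) (x : lp (fun _ : ℤ => H) 2) (n : ℤ) :
    shiftLin H a x n = x (n + a) := rfl

theorem norm_shiftLin (a : ℤ) (x : lp (fun _ : ℤ => H) 2) : ‖shiftLin H a x‖ = ‖x‖ := by
  have h0 : 0 < (2 : ℝ≥0∞).toReal := by simp
  have h : ‖shiftLin H a x‖ ^ (2 : ℝ≥0∞).toReal = ‖x‖ ^ (2 : ℝ≥0∞).toReal := by
    rw [lp.norm_rpow_eq_tsum h0, lp.norm_rpow_eq_tsum h0]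
    exact (Equiv.addRight a).tsum_eq (fun n => ‖x n‖ ^ (2 : ℝ≥0∞).toReal)
  exact (Real.rpow_left_inj (norm_nonneg _) (norm_nonneg _) h0.ne').mp h

/-- The bilateral shift as a unitary operator. -/
def shiftEquiv (H : Type u) [NormedAddCommGroup H] [InnerProductSpace ℂ H] :
    lp (fun _ : ℤ => H) 2 ≃ₗᵢ[ℂ] lp (fun _ : ℤ => H) 2 where
  toLinearEquiv := LinearEquiv.ofLinearMap (shiftLin H 1) (shiftLin H (-1))
    (by ext x n; simp [shiftLin_apply]) (by ext x n; simp [shiftLin_apply])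
  norm_map' x := norm_shiftLin 1 x

theorem norm_single_two (x : H) : ‖(lp.single 2 0 x : lp (fun _ : ℤ => H) 2)‖ = ‖x‖ := by
  have h : ⟪(lp.single 2 0 x : lp (fun _ : ℤ => H) 2), lp.single 2 0 x⟫_ℂ = ⟪x, x⟫_ℂ := by
    rw [lp.inner_single_left, lp.single_apply_self]
  rw [inner_self_eq_norm_sq_to_K, inner_self_eq_norm_sq_to_K] at h
  have h' : ‖(lp.single 2 0 x : lp (fun _ : ℤ => H) 2)‖ ^ 2 = ‖x‖ ^ 2 := by exact_mod_cast h
  exact (sq_eq_sq₀ (norm_nonneg _) (norm_nonneg _)).mp h'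

/-- The embedding of `H` as the coordinate `0` of `ℓ²(ℤ; H)`. -/
def embedZero (H : Type u) [NormedAddCommGroup H] [InnerProductSpace ℂ H] :
    H →ₗᵢ[ℂ] lp (fun _ : ℤ => H) 2 where
  toLinearMap := (lp.singleContinuousLinearMap ℂ (fun _ : ℤ => H) 2 0).toLinearMap
  norm_map' := norm_single_two

variable [CompleteSpace H]

/-- The involution of `ℓ²(ℤ; H)` that acts on the coordinates `0` and `1` by the block operator
with rows `(0, K*)` and `(K, 1 - K K*)`. -/
def blockLin (K : H →ₗᵢ[ℂ] H) : lp (fun _ : ℤ => H) 2 →ₗ[ℂ] lp (fun _ : ℤ => H) 2 :=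
  let T : H →L[ℂ] H := K.toContinuousLinearMap
  let e (n : ℤ) := lp.evalCLM ℂ (fun _ : ℤ => H) 2 n
  let s (n : ℤ) := lp.singleContinuousLinearMap ℂ (fun _ : ℤ => H) 2 n
  (ContinuousLinearMap.id ℂ _ + s 0 ∘L (ContinuousLinearMap.adjoint T ∘L e 1 - e 0)
    + s 1 ∘L (T ∘L e 0 - T ∘L ContinuousLinearMap.adjoint T ∘L e 1)).toLinearMap

theorem blockLin_apply (K : H →ₗᵢ[ℂ] H) (x : lp (fun _ : ℤ => H) 2) :
    blockLin K x = x
      + lp.single 2 0 (ContinuousLinearMap.adjoint K.toContinuousLinearMap (x 1) - x 0)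
      + lp.single 2 1 (K (x 0)
        - K (ContinuousLinearMap.adjoint K.toContinuousLinearMap (x 1))) := rfl

theorem adjoint_apply_self (K : H →ₗᵢ[ℂ] H) (f : H) :
    ContinuousLinearMap.adjoint K.toContinuousLinearMap (K f) = f := by
  refine ext_inner_right ℂ fun v => ?_
  rw [ContinuousLinearMap.adjoint_inner_left]
  exact K.inner_map_map f v

theorem blockLin_blockLin (K : H →ₗᵢ[ℂ] H) (x : lp (fun _ : ℤ => H) 2) :
    blockLin K (blockLin K x) = x := by
  have h0 : blockLin K x 0 = ContinuousLinearMap.adjoint K.toContinuousLinearMap (x 1) := by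
    simp [blockLin_apply]
  have h1 : blockLin K x 1 = x 1 + (K (x 0)
      - K (ContinuousLinearMap.adjoint K.toContinuousLinearMap (x 1))) := by
    simp [blockLin_apply]
  rw [blockLin_apply K (blockLin K x), h0, h1, map_add, map_sub, adjoint_apply_self,
    adjoint_apply_self]
  ext n
  rw [blockLin_apply]
  by_cases hn0 : n = 0
  · subst hn0; simp
  · by_cases hn1 : n = 1
    · subst hn1; simp; abel
    · simp [hn0, hn1]

theorem inner_blockLin (K : H →ₗᵢ[ℂ] H) (x y : lp (fun _ : ℤ => H) 2) :
    ⟪blockLin K x, y⟫_ℂ = ⟪x, blockLin K y⟫_ℂ := by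
  have hK : ∀ a b : H, ⟪K a, b⟫_ℂ
      = ⟪a, ContinuousLinearMap.adjoint K.toContinuousLinearMap b⟫_ℂ := fun a b => by
    rw [ContinuousLinearMap.adjoint_inner_right]; rfl
  have hK' : ∀ a b : H, ⟪a, K b⟫_ℂ
      = ⟪ContinuousLinearMap.adjoint K.toContinuousLinearMap a, b⟫_ℂ := fun a b => by
    rw [ContinuousLinearMap.adjoint_inner_left]; rfl
  simp only [blockLin_apply, inner_add_left, inner_add_right, lp.inner_single_left,
    lp.inner_single_right, inner_sub_left, inner_sub_right, hK, hK']
  ring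

/-- The block involution as a unitary operator. -/
def blockEquiv (K : H →ₗᵢ[ℂ] H) : lp (fun _ : ℤ => H) 2 ≃ₗᵢ[ℂ] lp (fun _ : ℤ => H) 2 where
  toLinearEquiv := LinearEquiv.ofInvolutive (blockLin K) (blockLin_blockLin K)
  norm_map' x := by
    have h : ⟪blockLin K x, blockLin K x⟫_ℂ = ⟪x, x⟫_ℂ := by
      rw [inner_blockLin, blockLin_blockLin]
    rw [inner_self_eq_norm_sq_to_K, inner_self_eq_norm_sq_to_K] at h
    have h' : ‖blockLin K x‖ ^ 2 = ‖x‖ ^ 2 := by exact_mod_cast h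
    exact (sq_eq_sq₀ (norm_nonneg _) (norm_nonneg _)).mp h'

theorem shift_block_embedZero (K : H →ₗᵢ[ℂ] H) (f : H) :
    (blockEquiv K).trans (shiftEquiv H) (embedZero H f) = embedZero H (K f) := by
  have h : (blockEquiv K).trans (shiftEquiv H) (embedZero H f)
      = shiftLin H 1 (blockLin K (lp.single 2 0 f)) := rfl
  have h' : embedZero H (K f) = lp.single 2 0 (K f) := rfl
  rw [h, h', blockLin_apply]
  ext n
  rw [shiftLin_apply]
  by_cases hn : n = 0
  · subst hn; simp
  · by_cases hn1 : n + 1 = 0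
    · simp [hn1, hn]
    · simp [hn]

end Extension

/-! ### The spectral theorem for unitary operators -/

section Spectral

variable {H : Type u} [NormedAddCommGroup H] [InnerProductSpace ℂ H] [CompleteSpace H]

/-- The continuous functional calculus of a unitary operator, on functions on the circle. -/
theorem exists_functionalCalculus (U : H ≃ₗᵢ[ℂ] H) :
    ∃ Φ : C(Circle, ℂ) →⋆ₐ[ℂ] (H →L[ℂ] H),
      ∀ f, Φ ⟨fun z => (z : ℂ), continuous_subtype_val⟩ f = U f := by
  let a : H →L[ℂ] H := ((Unitary.linearIsometryEquiv (𝕜 := ℂ) (H := H)).symm U : _)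
  have hau : a ∈ unitary (H →L[ℂ] H) :=
    ((Unitary.linearIsometryEquiv (𝕜 := ℂ) (H := H)).symm U).2
  have haU : ∀ f, a f = U f := fun f => rfl
  have hn : IsStarNormal a := isStarNormal_of_mem_unitary hau
  have hsp := spectrum.subset_circle_of_unitary (𝕜 := ℂ) hau
  let r : C(spectrum ℂ a, Circle) :=
    ⟨fun z => ⟨z.1, by simpa [Submonoid.unitSphere] using hsp z.2⟩, by
      exact Continuous.subtype_mk continuous_subtype_val _⟩
  refine ⟨(cfcHom (R := ℂ) hn).comp (ContinuousMap.compStarAlgHom' ℂ ℂ r), fun f => ?_⟩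
  rw [← haU]
  congr 1
  exact cfcHom_id (R := ℂ) hn

/-- The scalar measures of a functional calculus. -/
theorem exists_scalarMeasure (Φ : C(Circle, ℂ) →⋆ₐ[ℂ] (H →L[ℂ] H)) (f : H) :
    ∃ μ : Measure Circle, IsFiniteMeasure μ ∧
      ∀ φ : C(Circle, ℂ), ∫ z, φ z ∂μ = ⟪f, Φ φ f⟫_ℂ := by
  let c : C(ℝ, ℂ) := ⟨fun t => (t : ℂ), Complex.continuous_ofReal⟩
  let Λ₀ : CompactlySupportedContinuousMap Circle ℝ →ₗ[ℝ] ℝ :=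
    { toFun := fun φ => (⟪f, Φ (c.comp φ.toContinuousMap) f⟫_ℂ).re
      map_add' := fun φ ψ => by
        have : c.comp (φ + ψ).toContinuousMap
            = c.comp φ.toContinuousMap + c.comp ψ.toContinuousMap := by
          ext z; simp [c]
        rw [this, map_add, add_apply, inner_add_right, Complex.add_re]
      map_smul' := fun t φ => by
        have : c.comp (t • φ).toContinuousMap = (t : ℂ) • c.comp φ.toContinuousMap := by
          ext z; simp [c]
        rw [this, map_smul, smul_apply, inner_smul_right]
        simp }
  have hpos : ∀ φ : CompactlySupportedContinuousMap Circle ℝ, 0 ≤ φ → 0 ≤ Λ₀ φ := by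
    intro φ hφ
    let ρ : C(Circle, ℂ) := ⟨fun z => ((Real.sqrt (φ z) : ℝ) : ℂ), by fun_prop⟩
    have h1 : c.comp φ.toContinuousMap = star ρ * ρ := by
      ext z
      have : (0 : ℝ) ≤ φ z := hφ z
      simp [c, ρ, ← Complex.ofReal_mul, Real.mul_self_sqrt this]
    change 0 ≤ (⟪f, Φ (c.comp φ.toContinuousMap) f⟫_ℂ).re
    rw [h1, map_mul, map_star, mul_apply_eq_comp, ContinuousLinearMap.star_eq_adjoint,
      ContinuousLinearMap.adjoint_inner_right]
    exact inner_self_nonneg (𝕜 := ℂ)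
  let Λ : CompactlySupportedContinuousMap Circle ℝ →ₚ[ℝ] ℝ := PositiveLinearMap.mk₀ Λ₀ hpos
  let μ := RealRMK.rieszMeasure Λ
  have hfin : IsFiniteMeasure μ := inferInstance
  have hsa : ∀ φ : C(Circle, ℝ), ((⟪f, Φ (c.comp φ) f⟫_ℂ).re : ℂ) = ⟪f, Φ (c.comp φ) f⟫_ℂ := by
    intro φ
    have h1 : star (c.comp φ) = c.comp φ := by ext z; simp [c]
    have h2 : ContinuousLinearMap.adjoint (Φ (c.comp φ)) = Φ (c.comp φ) := by
      rw [← ContinuousLinearMap.star_eq_adjoint, ← map_star, h1]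
    rw [← Complex.conj_eq_iff_re]
    rw [inner_conj_symm, ← ContinuousLinearMap.adjoint_inner_right, h2]
  have hreal : ∀ φ : C(Circle, ℝ), ((∫ z, φ z ∂μ : ℝ) : ℂ) = ⟪f, Φ (c.comp φ) f⟫_ℂ := by
    intro φ
    have := RealRMK.integral_rieszMeasure Λ (CompactlySupportedContinuousMap.continuousMapEquiv φ)
    rw [← hsa, ← Complex.ofReal_inj] at *
    exact this
  refine ⟨μ, hfin, fun φ => ?_⟩
  let φr : C(Circle, ℝ) := ⟨fun z => (φ z).re, by fun_prop⟩
  let φi : C(Circle, ℝ) := ⟨fun z => (φ z).im, by fun_prop⟩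
  have hint : Integrable φ μ := φ.continuous.integrable_of_hasCompactSupport
    (HasCompactSupport.of_compactSpace _)
  have h1 : φ = c.comp φr + Complex.I • c.comp φi := by
    ext z; simp [c, φr, φi, mul_comm Complex.I]
  have h2 : ∫ z, φ z ∂μ = ((∫ z, φr z ∂μ : ℝ) : ℂ) + Complex.I * ((∫ z, φi z ∂μ : ℝ) : ℂ) := by
    rw [← integral_re_add_im hint, mul_comm Complex.I]
    rfl
  rw [h2, hreal, hreal]
  conv_rhs => rw [h1]
  rw [map_add, map_smul, add_apply, smul_apply,
    inner_add_right, inner_smul_right]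

/-- The filter on `C(𝕋)` of convergence to the indicator of `s` in `L²(ν)` for every finite `ν`. -/
def approxFilter (s : Set Circle) : Filter C(Circle, ℂ) :=
  ⨅ ν : FiniteMeasure Circle,
    comap (fun φ => eLpNorm (⇑φ - s.indicator (fun _ => (1 : ℂ))) 2 (ν : Measure Circle)) (𝓝 0)

theorem tendsto_eLpNorm_approxFilter (s : Set Circle) (μ : Measure Circle) [hμ : IsFiniteMeasure μ] :
    Tendsto (fun φ : C(Circle, ℂ) => eLpNorm (⇑φ - s.indicator (fun _ => (1 : ℂ))) 2 μ)
      (approxFilter s) (𝓝 0) :=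
  tendsto_comap.mono_left (iInf_le _ (⟨μ, hμ⟩ : FiniteMeasure Circle))

theorem approxFilter_neBot {s : Set Circle} (hs : MeasurableSet s) : (approxFilter s).NeBot := by
  refine iInf_neBot_of_directed' ?_ ?_
  · intro ν₁ ν₂
    have key : ∀ ν ν' : FiniteMeasure Circle, (ν : Measure Circle) ≤ (ν' : Measure Circle) →
        comap (fun φ : C(Circle, ℂ) =>
          eLpNorm (⇑φ - s.indicator (fun _ => (1 : ℂ))) 2 (ν' : Measure Circle)) (𝓝 0)
        ≤ comap (fun φ : C(Circle, ℂ) =>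
          eLpNorm (⇑φ - s.indicator (fun _ => (1 : ℂ))) 2 (ν : Measure Circle)) (𝓝 0) := by
      intro ν ν' h
      rw [← tendsto_iff_comap]
      exact tendsto_of_tendsto_of_tendsto_of_le_of_le tendsto_const_nhds tendsto_comap
        (fun φ => bot_le) (fun φ => eLpNorm_mono_measure _ h)
    refine ⟨ν₁ + ν₂, key _ _ ?_, key _ _ ?_⟩
    · rw [FiniteMeasure.toMeasure_add]; exact Measure.le_add_right le_rfl
    · rw [FiniteMeasure.toMeasure_add]; exact Measure.le_add_left le_rfl
  · intro ν
    rw [comap_neBot_iff]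
    intro t ht
    obtain ⟨ε, hε, hεt⟩ := ENNReal.nhds_zero_basis_Iic.mem_iff.mp ht
    have hmem : MemLp (s.indicator (fun _ => (1 : ℂ))) 2 (ν : Measure Circle) :=
      memLp_indicator_const 2 hs 1 (Or.inr (measure_ne_top _ _))
    obtain ⟨φ, -, h1, h2, -⟩ := hmem.exists_hasCompactSupport_eLpNorm_sub_le (by simp) hε.ne'
    refine ⟨⟨φ, h2⟩, hεt ?_⟩
    rw [Set.mem_Iic, eLpNorm_sub_comm]
    exact h1

theorem tendsto_toLp_approxFilter {s : Set Circle} (hs : MeasurableSet s) (μ : Measure Circle)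
    [IsFiniteMeasure μ] :
    Tendsto (fun φ : C(Circle, ℂ) => ContinuousMap.toLp (E := ℂ) 2 μ ℂ φ) (approxFilter s)
      (𝓝 (indicatorConstLp 2 hs (measure_ne_top μ s) 1)) :=
  (Lp.tendsto_Lp_iff_tendsto_eLpNorm'' (fun φ : C(Circle, ℂ) => ⇑φ)
    (fun φ => φ.continuous.memLp_of_hasCompactSupport (HasCompactSupport.of_compactSpace _))
    _ (memLp_indicator_const 2 hs 1 (Or.inr (measure_ne_top _ _)))).mpr
    (tendsto_eLpNorm_approxFilter s μ)

theorem norm_calculus (Φ : C(Circle, ℂ) →⋆ₐ[ℂ] (H →L[ℂ] H)) (f : H) (μ : Measure Circle)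
    [IsFiniteMeasure μ] (hμ : ∀ φ : C(Circle, ℂ), ∫ z, φ z ∂μ = ⟪f, Φ φ f⟫_ℂ) (φ : C(Circle, ℂ)) :
    ‖Φ φ f‖ = ‖ContinuousMap.toLp (E := ℂ) 2 μ ℂ φ‖ := by
  have h : ⟪Φ φ f, Φ φ f⟫_ℂ
      = ⟪ContinuousMap.toLp (E := ℂ) 2 μ ℂ φ, ContinuousMap.toLp (E := ℂ) 2 μ ℂ φ⟫_ℂ := by
    rw [ContinuousMap.inner_toLp, ← ContinuousLinearMap.adjoint_inner_right,
      ← ContinuousLinearMap.star_eq_adjoint, ← map_star, ← mul_apply_eq_comp, ← map_mul, ← hμ]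
    refine integral_congr_ae (Eventually.of_forall fun z => ?_)
    simp [mul_comm]
  rw [inner_self_eq_norm_sq_to_K, inner_self_eq_norm_sq_to_K] at h
  have h' : ‖Φ φ f‖ ^ 2 = ‖ContinuousMap.toLp (E := ℂ) 2 μ ℂ φ‖ ^ 2 := by exact_mod_cast h
  exact (sq_eq_sq₀ (norm_nonneg _) (norm_nonneg _)).mp h'

theorem exists_limit_calculus (Φ : C(Circle, ℂ) →⋆ₐ[ℂ] (H →L[ℂ] H)) (f : H) (μ : Measure Circle)
    [IsFiniteMeasure μ] (hμ : ∀ φ : C(Circle, ℂ), ∫ z, φ z ∂μ = ⟪f, Φ φ f⟫_ℂ)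
    {s : Set Circle} (hs : MeasurableSet s) :
    ∃ v : H, Tendsto (fun φ => Φ φ f) (approxFilter s) (𝓝 v) ∧ ‖v‖ ^ 2 = μ.real s ∧
      ⟪f, v⟫_ℂ = (μ.real s : ℂ) := by
  have hne := approxFilter_neBot hs
  have hL := tendsto_toLp_approxFilter hs μ
  have hc := hL.cauchy_map
  have hdist : ∀ φ ψ : C(Circle, ℂ), dist (Φ φ f) (Φ ψ f)
      = dist (ContinuousMap.toLp (E := ℂ) 2 μ ℂ φ) (ContinuousMap.toLp (E := ℂ) 2 μ ℂ ψ) := by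
    intro φ ψ
    rw [dist_eq_norm, dist_eq_norm, ← map_sub, ← norm_calculus Φ f μ hμ, map_sub, sub_apply]
  have hc' : Cauchy (map (fun φ => Φ φ f) (approxFilter s)) := by
    rw [cauchy_map_iff] at hc ⊢
    refine ⟨hne, ?_⟩
    have h2 := hc.2
    rw [Metric.uniformity_eq_comap_nhds_zero, tendsto_comap_iff] at h2 ⊢
    refine h2.congr fun p => ?_
    exact (hdist p.1 p.2).symm
  obtain ⟨v, hv⟩ := CompleteSpace.complete hc'
  have hv' : Tendsto (fun φ => Φ φ f) (approxFilter s) (𝓝 v) := hv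
  refine ⟨v, hv', ?_, ?_⟩
  · have h1 : ‖v‖ = ‖indicatorConstLp (E := ℂ) 2 hs (measure_ne_top μ s) 1‖ :=
      tendsto_nhds_unique hv'.norm (hL.norm.congr fun φ => (norm_calculus Φ f μ hμ φ).symm)
    rw [h1, norm_indicatorConstLp (by simp) (by simp)]
    simp only [norm_one, one_mul, ENNReal.toReal_ofNat]
    rw [← Real.sqrt_eq_rpow, Real.sq_sqrt measureReal_nonneg]
  · let o : Lp ℂ 2 μ := indicatorConstLp 2 MeasurableSet.univ (measure_ne_top μ _) 1
    have h1 : Tendsto (fun φ : C(Circle, ℂ) => ⟪o, ContinuousMap.toLp (E := ℂ) 2 μ ℂ φ⟫_ℂ)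
        (approxFilter s) (𝓝 ⟪o, indicatorConstLp 2 hs (measure_ne_top μ s) 1⟫_ℂ) :=
      tendsto_const_nhds.inner hL
    have h2 : ∀ φ : C(Circle, ℂ), ⟪o, ContinuousMap.toLp (E := ℂ) 2 μ ℂ φ⟫_ℂ = ⟪f, Φ φ f⟫_ℂ := by
      intro φ
      rw [L2.inner_indicatorConstLp_one, ← hμ, Measure.restrict_univ]
      exact integral_congr_ae (ContinuousMap.coeFn_toLp μ φ)
    have h3 : ⟪o, indicatorConstLp 2 hs (measure_ne_top μ s) 1⟫_ℂ = (μ.real s : ℂ) := by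
      rw [L2.inner_indicatorConstLp_one, Measure.restrict_univ, integral_indicatorConstLp]
      simp
    rw [h3] at h1
    exact tendsto_nhds_unique (tendsto_const_nhds.inner hv') (h1.congr h2)

/-- The spectral theorem for unitary operators. -/
theorem exists_isSpectralMeasureOf (U : H ≃ₗᵢ[ℂ] H) :
    ∃ E : ProjectionValuedMeasure H, E.IsSpectralMeasureOf U := by
  classical
  obtain ⟨Φ, hΦ⟩ := exists_functionalCalculus U
  choose m hfin hm using exists_scalarMeasure Φ
  choose! e he hnorm hinner using
    fun (s : Set Circle) (f : H) (hs : MeasurableSet s) =>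
      exists_limit_calculus Φ f (m f) (hm f) hs
  have hmass : ∀ f, (m f).real Set.univ = ‖f‖ ^ 2 := by
    intro f
    have h := hm f 1
    rw [map_one, one_apply_eq_self, inner_self_eq_norm_sq_to_K] at h
    simp only [ContinuousMap.one_apply, integral_const] at h
    have h' : (((m f).real Set.univ : ℝ) : ℂ) = ((‖f‖ ^ 2 : ℝ) : ℂ) := by simpa using h
    exact_mod_cast h'
  let P : Set Circle → (H →L[ℂ] H) := fun s =>
    if hs : MeasurableSet s then
      LinearMap.mkContinuous
        { toFun := e s
          map_add' := fun f h => by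
            have := approxFilter_neBot hs
            refine tendsto_nhds_unique (he s (f + h) hs) ?_
            simpa using (he s f hs).add (he s h hs)
          map_smul' := fun c f => by
            have := approxFilter_neBot hs
            refine tendsto_nhds_unique (he s (c • f) hs) ?_
            simpa using (he s f hs).const_smul c } 1
        (fun f => by
          rw [one_mul]
          refine le_of_sq_le_sq ?_ (norm_nonneg _)
          change ‖e s f‖ ^ 2 ≤ ‖f‖ ^ 2
          rw [hnorm s f hs, ← hmass]
          exact measureReal_mono (Set.subset_univ s))
    else 0
  have hP : ∀ s, MeasurableSet s → ∀ f, P s f = e s f := by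
    intro s hs f
    simp only [P, dif_pos hs]
    rfl
  have hPi : ∀ s, MeasurableSet s → ∀ f, ⟪f, P s f⟫_ℂ = ((m f).real s : ℂ) := by
    intro s hs f
    rw [hP s hs, hinner s f hs]
  have hPi' : ∀ s, MeasurableSet s → ∀ f, ⟪P s f, f⟫_ℂ = ((m f).real s : ℂ) := by
    intro s hs f
    rw [← inner_conj_symm, hPi s hs, Complex.conj_ofReal]
  have hPn : ∀ s, MeasurableSet s → ∀ f, ‖P s f‖ ^ 2 = (m f).real s := by
    intro s hs f
    rw [hP s hs, hnorm s f hs]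
  have hext : ∀ S T : H →L[ℂ] H, (∀ f, ⟪S f, f⟫_ℂ = ⟪T f, f⟫_ℂ) → S = T := by
    intro S T h
    have := (ext_inner_map (S : H →ₗ[ℂ] H) (T : H →ₗ[ℂ] H)).mp h
    exact ContinuousLinearMap.coe_injective this
  have hadj : ∀ s, MeasurableSet s → ContinuousLinearMap.adjoint (P s) = P s := by
    intro s hs
    refine hext _ _ fun f => ?_
    rw [ContinuousLinearMap.adjoint_inner_left, hPi s hs, hPi' s hs]
  let E : ProjectionValuedMeasure H :=
    { proj := P
      isStarProjection := by
        intro s hs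
        refine ⟨hext _ _ fun f => ?_, hadj s hs⟩
        rw [mul_apply_eq_comp, hPi' s hs, ← ContinuousLinearMap.adjoint_inner_right, hadj s hs,
          inner_self_eq_norm_sq_to_K, ← hPn s hs]
        simp
      proj_empty := by
        refine hext _ _ fun f => ?_
        rw [hPi' _ MeasurableSet.empty]
        simp
      proj_univ := by
        refine hext _ _ fun f => ?_
        rw [hPi' _ MeasurableSet.univ, hmass, one_apply_eq_self,
          inner_self_eq_norm_sq_to_K]
        simp
      hasSum_iUnion := by
        intro s hs hd f
        have hU : MeasurableSet (⋃ i, s i) := MeasurableSet.iUnion hs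
        have hdiff : ∀ t : Finset ℕ, MeasurableSet ((⋃ i, s i) \ ⋃ i ∈ t, s i) := fun t =>
          hU.diff (Finset.measurableSet_biUnion t fun i _ => hs i)
        have hmd : ∀ (t : Finset ℕ) (h : H), (m h).real ((⋃ i, s i) \ ⋃ i ∈ t, s i)
            = (m h).real (⋃ i, s i) - ∑ i ∈ t, (m h).real (s i) := by
          intro t h
          rw [measureReal_sdiff (Set.iUnion₂_subset fun i _ => Set.subset_iUnion s i)
            (Finset.measurableSet_biUnion t fun i _ => hs i),
            measureReal_biUnion_finset (fun i _ j _ hij => hd hij) (fun i _ => hs i)]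
        have hop : ∀ t : Finset ℕ, P ((⋃ i, s i) \ ⋃ i ∈ t, s i)
            = P (⋃ i, s i) - ∑ i ∈ t, P (s i) := by
          intro t
          refine hext _ _ fun h => ?_
          rw [hPi' _ (hdiff t), hmd, sub_apply, inner_sub_left, hPi' _ hU, sum_apply, sum_inner,
            Finset.sum_congr rfl fun i _ => hPi' _ (hs i) h]
          push_cast
          rfl
        have hsum : HasSum (fun i => (m f).real (s i)) ((m f).real (⋃ i, s i)) := by
          have h1 : ∑' i, m f (s i) = m f (⋃ i, s i) := (measure_iUnion hd hs).symm
          have h2 := ENNReal.hasSum_toReal (f := fun i => m f (s i))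
            (by rw [h1]; exact measure_ne_top _ _)
          rw [← ENNReal.tsum_toReal_eq (fun i => measure_ne_top _ _), h1] at h2
          exact h2
        have hz : Tendsto (fun t : Finset ℕ => ‖P (⋃ i, s i) f - ∑ i ∈ t, P (s i) f‖ ^ 2) atTop
            (𝓝 0) := by
          have h1 : ∀ t : Finset ℕ, ‖P (⋃ i, s i) f - ∑ i ∈ t, P (s i) f‖ ^ 2
              = (m f).real (⋃ i, s i) - ∑ i ∈ t, (m f).real (s i) := by
            intro t
            rw [← hmd, ← hPn _ (hdiff t), hop, sub_apply, sum_apply]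
          simp only [h1]
          have := (tendsto_const_nhds (x := (m f).real (⋃ i, s i))).sub hsum
          simpa using this
        have hz' := hz.sqrt
        simp only [Real.sqrt_sq (norm_nonneg _), Real.sqrt_zero] at hz'
        have hz'' := tendsto_zero_iff_norm_tendsto_zero.mpr hz'
        have := (tendsto_const_nhds (x := P (⋃ i, s i) f)).sub hz''
        simpa [HasSum] using this }
  refine ⟨E, fun f => ?_⟩
  have hEm : E.scalarMeasure f = m f := by
    ext s hs
    rw [ProjectionValuedMeasure.scalarMeasure, Measure.ofMeasurable_apply s hs]
    change ENNReal.ofReal (⟪f, P s f⟫_ℂ).re = _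
    rw [hPi s hs, Complex.ofReal_re, ofReal_measureReal]
  rw [hEm]
  have h := hm f ⟨fun z => (z : ℂ), continuous_subtype_val⟩
  rw [hΦ] at h
  exact h

end Spectral

theorem exists_isScalarSpectralMeasure {H : Type u} [NormedAddCommGroup H]
    [InnerProductSpace ℂ H] [CompleteSpace H] (K : H →ₗᵢ[ℂ] H) (g : H) :
    ∃ μ : Measure Circle, IsScalarSpectralMeasure K g μ := by
  obtain ⟨E', hE'⟩ := exists_isSpectralMeasureOf ((blockEquiv K).trans (shiftEquiv H))
  exact ⟨_, _, inferInstance, inferInstance, inferInstance, embedZero H, _, E',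
    shift_block_embedZero K, hE', rfl⟩

/-- The spectral measure `μ_g` of the isometry `K` with respect to the vector `g`. The measure does
not depend on the unitary extension through which it is defined. -/
def scalarSpectralMeasure {H : Type u} [NormedAddCommGroup H] [InnerProductSpace ℂ H]
    [CompleteSpace H] (K : H →ₗᵢ[ℂ] H) (g : H) : Measure Circle :=
  (exists_isScalarSpectralMeasure K g).choose

theorem scalarSpectralMeasure_spec {H : Type u} [NormedAddCommGroup H] [InnerProductSpace ℂ H]
    [CompleteSpace H] (K : H →ₗᵢ[ℂ] H) (g : H) :
    IsScalarSpectralMeasure K g (scalarSpectralMeasure K g) :=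
  (exists_isScalarSpectralMeasure K g).choose_spec

/-! ### The Koopman operator and the Wasserstein distance -/

/-- The Koopman operator `g ↦ g ∘ F` on `L²(Ω, ω)` of a measure-preserving map `F`. -/
def koopman {Ω : Type u} [MeasurableSpace Ω] {ω : Measure Ω} (F : Ω → Ω)
    (hF : MeasurePreserving F ω ω) : Lp ℂ 2 ω →ₗᵢ[ℂ] Lp ℂ 2 ω :=
  Lp.compMeasurePreservingₗᵢ ℂ F hF

/-- The `W₁` distance of two probability measures on `𝕋`, as the supremum over all `1`-Lipschitz
test functions. It is `[0,∞]`-valued, so that no convention about unbounded suprema enters. -/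
def wassersteinOne (μ ν : Measure Circle) : ℝ≥0∞ :=
  ⨆ (φ : Circle → ℝ) (_ : LipschitzWith 1 φ), ENNReal.ofReal (∫ z, φ z ∂μ - ∫ z, φ z ∂ν)

/-! ### The algorithm `mpEDMD` -/

/-- The matrix with rows `Ψ(x⁽ᵐ⁾) = (ψ₁(x⁽ᵐ⁾), …, ψ_N(x⁽ᵐ⁾))`. -/
def dataMatrix {Ω : Type u} {M N : ℕ} (ψ : Fin N → Ω → ℂ) (x : Fin M → Ω) :
    Matrix (Fin M) (Fin N) ℂ :=
  Matrix.of fun m j => ψ j (x m)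

/-- The matrix `W = diag(w₁, …, w_M)` of quadrature weights. -/
def weightMatrix {M : ℕ} (w : Fin M → ℝ) : Matrix (Fin M) (Fin M) ℂ :=
  Matrix.diagonal fun m => (w m : ℂ)

/-- `G = Ψ_X^* W Ψ_X`. -/
def gramMatrix {Ω : Type u} {M N : ℕ} (ψ : Fin N → Ω → ℂ) (x : Fin M → Ω) (w : Fin M → ℝ) :
    Matrix (Fin N) (Fin N) ℂ :=
  (dataMatrix ψ x).conjTranspose * weightMatrix w * dataMatrix ψ x

/-- `A = Ψ_X^* W Ψ_Y`, with the snapshots `y⁽ᵐ⁾ = F(x⁽ᵐ⁾)`. -/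
def crossMatrix {Ω : Type u} {M N : ℕ} (F : Ω → Ω) (ψ : Fin N → Ω → ℂ) (x : Fin M → Ω)
    (w : Fin M → ℝ) : Matrix (Fin N) (Fin N) ℂ :=
  (dataMatrix ψ x).conjTranspose * weightMatrix w * dataMatrix ψ (F ∘ x)

/-- A run of `mpEDMD` on the matrices `G` and `A`: a singular value decomposition
`G^{-1/2} A^* G^{-1/2} = U₁ Σ U₂^*` and an eigendecomposition `U₂ U₁^* = V̂ Λ V̂^*`. Neither need be
unique. The eigenvalues are those of a unitary matrix, hence they lie on `𝕋`. -/
structure Output {N : ℕ} (G A : Matrix (Fin N) (Fin N) ℂ) where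
  U₁ : Matrix.unitaryGroup (Fin N) ℂ
  U₂ : Matrix.unitaryGroup (Fin N) ℂ
  /-- the singular values -/
  sigma : Fin N → ℝ
  sigma_nonneg : ∀ j, 0 ≤ sigma j
  svd : (CFC.sqrt G)⁻¹ * A.conjTranspose * (CFC.sqrt G)⁻¹
    = U₁.1 * Matrix.diagonal (fun j => (sigma j : ℂ)) * U₂.1.conjTranspose
  Vhat : Matrix.unitaryGroup (Fin N) ℂ
  /-- the eigenvalues -/
  eigenvalue : Fin N → Circle
  eigen : U₂.1 * U₁.1.conjTranspose
    = Vhat.1 * Matrix.diagonal (fun j => (eigenvalue j : ℂ)) * Vhat.1.conjTranspose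

/-- The eigenvectors `v_j`, the columns of `V = G^{-1/2} V̂`. -/
def Output.eigenvector {N : ℕ} {G A : Matrix (Fin N) (Fin N) ℂ} (out : Output G A) (j : Fin N) :
    Fin N → ℂ :=
  fun i => ((CFC.sqrt G)⁻¹ * out.Vhat.1) i j

/-- The measure `∑_j |v_j^* G c|² δ_{λ_j}` of a coefficient vector `c`. -/
def Output.spectralMeasure {N : ℕ} {G A : Matrix (Fin N) (Fin N) ℂ} (out : Output G A)
    (c : Fin N → ℂ) : Measure Circle :=
  ∑ j, ENNReal.ofReal (‖star (out.eigenvector j) ⬝ᵥ (G.mulVec c)‖ ^ 2) •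
    Measure.dirac (out.eigenvalue j)

/-- The coefficient vector `c`, normalized so that `c^* G c = 1`. -/
def normalizedCoeff {N : ℕ} (G : Matrix (Fin N) (Fin N) ℂ) (c : Fin N → ℂ) : Fin N → ℂ :=
  ((Real.sqrt (star c ⬝ᵥ (G.mulVec c)).re)⁻¹ : ℝ) • c

end MpEDMD

end

/-! The argument compares moments. Two ingredients are independent of each other.

Analytic side: the Wasserstein distance of two probability measures on the circle is controlled by
finitely many moments. If the moments of order below `2m - 1` differ by at most `δ`, then
`wassersteinOne_le_of_moments` bounds the distance by `9/m + 4mδ`. The test function is replaced by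
a trigonometric polynomial through a positive kernel. With `m` about `L/2` and `δ` tending to `0`
this yields a bound of order `1/L`; the factor `log L` is not needed and only weakens it.

Algebraic side: the moments of `μ_g` are `⟪g, K^l g⟫`, while those of the computed measure are `⟪y,
B^l y⟫` with `y = √G c` and `B = U₂U₁^*`, the unitary factor in the polar decomposition `S = BP` of
`S = G^{-1/2} A G^{-1/2}`. As `M → ∞`, `S` tends to the matrix `T` of the compression of `K` in
orthonormal coordinates. If `T` is singular, `B` need not converge. However, as long as `K^l g`
stays in the span of the dictionary, `T` moves its coordinate vector `x_l` to `x_{l+1}` and `T^*`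
moves it back. Hence `P² x_l → T^*T x_l = x_l`, so `P x_l → x_l`, and `B x_l` has the same limit as
`S x_l`, which is `x_{l+1}`. This is `tendsto_unitary_pow_mulVec`; it gives convergence of all
moments of order at most `L` to the right values.

If `T` is invertible, its polar factor depends continuously on the matrix, so `B` converges and with
it every moment. By the moment bound the computed measures form a Cauchy sequence in the Wasserstein
distance, and the distance to `μ_g` has a limit. -/

noncomputable section

namespace MpEDMD

universe u

/-! ### Moments of the spectral measure of an isometry. -/

section SpectralMoments

variable {H : Type u} [NormedAddCommGroup H] [InnerProductSpace ℂ H] [CompleteSpace H]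

namespace ProjectionValuedMeasure

variable (E : ProjectionValuedMeasure H)

theorem proj_proj_self {s : Set Circle} (hs : MeasurableSet s) (f : H) :
    E.proj s (E.proj s f) = E.proj s f :=
  congrArg (fun T : H →L[ℂ] H => T f) (E.isStarProjection s hs).isIdempotentElem.eq

theorem inner_proj_left {s : Set Circle} (hs : MeasurableSet s) (f h : H) :
    ⟪E.proj s f, h⟫_ℂ = ⟪f, E.proj s h⟫_ℂ := by
  have h2 : ContinuousLinearMap.adjoint (E.proj s) = E.proj s :=
    (E.isStarProjection s hs).isSelfAdjoint
  rw [← ContinuousLinearMap.adjoint_inner_right, h2]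

theorem proj_union {s t : Set Circle} (hs : MeasurableSet s) (ht : MeasurableSet t)
    (hd : Disjoint s t) (f : H) : E.proj (s ∪ t) f = E.proj s f + E.proj t f := by
  let S : ℕ → Set Circle := fun i => if i = 0 then s else if i = 1 then t else ∅
  have hU : ⋃ i, S i = s ∪ t := by
    ext z
    simp only [Set.mem_iUnion, Set.mem_union, S]
    constructor
    · rintro ⟨i, hi⟩
      split_ifs at hi <;> simp_all
    · rintro (h | h)
      · exact ⟨0, by simpa using h⟩
      · exact ⟨1, by simpa using h⟩
  have h1 := E.hasSum_iUnion S (fun i => by simp only [S]; split_ifs <;> simp [hs, ht])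
    (fun i j hij => by
      simp only [Function.onFun, S]
      split_ifs <;> simp_all [disjoint_comm]) f
  rw [hU] at h1
  refine h1.unique ?_
  have h2 := hasSum_sum_of_ne_finset_zero (L := .unconditional ℕ)
    (f := fun i => E.proj (S i) f) (s := {0, 1})
    (fun i hi => by
      have : i ≠ 0 ∧ i ≠ 1 := by simpa using hi
      simp [S, this.1, this.2, E.proj_empty])
  simpa [S] using h2

/-- Multiplicativity is not part of the definition of a projection-valued measure and comes from
additivity: write `P`, `Q` for the two projections. Since `P + Q` is idempotent, applying it twice
to `Q f` gives `PQf + QPQf = 0`; a further `Q` gives `2 QPQf = 0`, hence `PQf = 0`. -/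
theorem proj_proj_of_disjoint {s t : Set Circle} (hs : MeasurableSet s) (ht : MeasurableSet t)
    (hd : Disjoint s t) (f : H) : E.proj s (E.proj t f) = 0 := by
  have h1 := E.proj_proj_self (hs.union ht) (E.proj t f)
  rw [E.proj_union hs ht hd, E.proj_union hs ht hd, E.proj_proj_self ht, map_add,
    E.proj_proj_self hs, map_add, E.proj_proj_self ht] at h1
  have h2 : E.proj s (E.proj t f) + E.proj t (E.proj s (E.proj t f)) = 0 := by
    have h3 : E.proj s (E.proj t f) + E.proj s (E.proj t f)
      + (E.proj t (E.proj s (E.proj t f)) + E.proj t f) = E.proj s (E.proj t f) + E.proj t f := h1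
    have h4 : E.proj s (E.proj t f) + E.proj t (E.proj s (E.proj t f)) =
      (E.proj s (E.proj t f) + E.proj s (E.proj t f)
      + (E.proj t (E.proj s (E.proj t f)) + E.proj t f)) -
      (E.proj s (E.proj t f) + E.proj t f) := by abel
    rw [h4, h3, sub_self]
  have h6 : E.proj t (E.proj s (E.proj t f)) = - E.proj s (E.proj t f) :=
    eq_neg_of_add_eq_zero_right h2
  have h7 := congrArg (E.proj t) h6
  rw [E.proj_proj_self ht, map_neg] at h7
  have h8 : E.proj t (E.proj s (E.proj t f)) = 0 := by
    have : (2 : ℂ) • E.proj t (E.proj s (E.proj t f)) = 0 := by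
      rw [two_smul]; nth_rewrite 1 [h7]; abel
    simpa using this
  rw [h8] at h6
  exact neg_eq_zero.mp h6.symm

theorem proj_proj {s t : Set Circle} (hs : MeasurableSet s) (ht : MeasurableSet t) (f : H) :
    E.proj s (E.proj t f) = E.proj (s ∩ t) f := by
  have h1 : E.proj s (E.proj t f) = E.proj (s ∩ t) (E.proj t f) + E.proj (s \ t) (E.proj t f) := by
    rw [← E.proj_union (hs.inter ht) (hs.diff ht) Set.disjoint_sdiff_inter.symm,
      Set.inter_union_sdiff]
  have h2 : E.proj t f = E.proj (s ∩ t) f + E.proj (t \ s) f := by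
    rw [← E.proj_union (hs.inter ht) (ht.diff hs)
      (by rw [Set.inter_comm]; exact Set.disjoint_sdiff_inter.symm), Set.inter_comm,
      Set.inter_union_sdiff]
  rw [h1, E.proj_proj_of_disjoint (hs.diff ht) ht Set.disjoint_sdiff_left, add_zero, h2, map_add,
    E.proj_proj_self (hs.inter ht), E.proj_proj_of_disjoint (hs.inter ht) (ht.diff hs)
      (Set.disjoint_left.mpr fun z hz hz' => hz'.2 hz.1), add_zero]

theorem scalarMeasure_apply (f : H) {s : Set Circle} (hs : MeasurableSet s) :
    E.scalarMeasure f s = ENNReal.ofReal (⟪f, E.proj s f⟫_ℂ).re :=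
  Measure.ofMeasurable_apply s hs

theorem inner_proj_self (f : H) {s : Set Circle} (hs : MeasurableSet s) :
    ⟪f, E.proj s f⟫_ℂ = ((‖E.proj s f‖ ^ 2 : ℝ) : ℂ) := by
  rw [← E.proj_proj_self hs, ← E.inner_proj_left hs, inner_self_eq_norm_sq_to_K,
    E.proj_proj_self hs]
  simp

theorem scalarMeasure_apply_eq_norm_sq (f : H) {s : Set Circle} (hs : MeasurableSet s) :
    E.scalarMeasure f s = ENNReal.ofReal (‖E.proj s f‖ ^ 2) := by
  rw [E.scalarMeasure_apply f hs, E.inner_proj_self f hs, Complex.ofReal_re]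

instance isFiniteMeasure_scalarMeasure (f : H) : IsFiniteMeasure (E.scalarMeasure f) :=
  ⟨by rw [E.scalarMeasure_apply f MeasurableSet.univ]; exact ENNReal.ofReal_lt_top⟩

theorem isProbabilityMeasure_scalarMeasure {f : H} (hf : ‖f‖ = 1) :
    IsProbabilityMeasure (E.scalarMeasure f) :=
  ⟨by rw [E.scalarMeasure_apply_eq_norm_sq f MeasurableSet.univ, E.proj_univ]; simp [hf]⟩

theorem scalarMeasure_proj (f : H) {s : Set Circle} (hs : MeasurableSet s) :
    E.scalarMeasure (E.proj s f) = (E.scalarMeasure f).restrict s := by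
  ext t ht
  rw [Measure.restrict_apply ht, E.scalarMeasure_apply_eq_norm_sq _ ht,
    E.scalarMeasure_apply_eq_norm_sq _ (ht.inter hs), E.proj_proj ht hs]

/-- Vectors in the ranges of `E(s)` and `E(sᶜ)` are orthogonal for the whole measure. -/
theorem scalarMeasure_smul_add_smul {f h : H} {s : Set Circle} (hs : MeasurableSet s)
    (hf : E.proj s f = f) (hh : E.proj sᶜ h = h) (a b : ℂ) :
    E.scalarMeasure (a • f + b • h)
      = ENNReal.ofReal (‖a‖ ^ 2) • E.scalarMeasure f
        + ENNReal.ofReal (‖b‖ ^ 2) • E.scalarMeasure h := by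
  ext t ht
  have horth : ⟪E.proj t f, E.proj t h⟫_ℂ = 0 := by
    rw [← hf, ← hh, E.proj_proj ht hs, E.proj_proj ht hs.compl,
      E.inner_proj_left (ht.inter hs), E.proj_proj_of_disjoint (ht.inter hs) (ht.inter hs.compl)
      (Set.disjoint_left.mpr fun z hz hz' => hz'.2 hz.2), inner_zero_right]
  have horth' : ⟪a • E.proj t f, b • E.proj t h⟫_ℂ = 0 := by
    rw [inner_smul_left, inner_smul_right, horth, mul_zero, mul_zero]
  have hsq := norm_add_sq_eq_norm_sq_add_norm_sq_of_inner_eq_zero _ _ horth'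
  rw [E.scalarMeasure_apply_eq_norm_sq _ ht, Measure.add_apply, Measure.smul_apply,
    Measure.smul_apply, E.scalarMeasure_apply_eq_norm_sq _ ht,
    E.scalarMeasure_apply_eq_norm_sq _ ht, smul_eq_mul, smul_eq_mul,
    ← ENNReal.ofReal_mul (sq_nonneg _), ← ENNReal.ofReal_mul (sq_nonneg _),
    ← ENNReal.ofReal_add (by positivity) (by positivity)]
  congr 1
  rw [map_add, map_smul, map_smul, sq, hsq, norm_smul, norm_smul]
  ring

end ProjectionValuedMeasure

theorem integrable_circle_of_continuous (μ : Measure Circle) [IsFiniteMeasure μ]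
    {G : Type*} [NormedAddCommGroup G] {φ : Circle → G} (hφ : Continuous φ) : Integrable φ μ :=
  hφ.integrable_of_hasCompactSupport (HasCompactSupport.of_compactSpace _)

namespace ProjectionValuedMeasure

variable {E : ProjectionValuedMeasure H} {U : H ≃ₗᵢ[ℂ] H}

/-- Polarization: for `‖a‖ = 1` the measure of `f + a h` is the sum of those of `f` and `h`, so the
cross terms of `⟪f + a h, U (f + a h)⟫` cancel. The values `a = 1` and `a = i` separate the two
terms. -/
theorem IsSpectralMeasureOf.inner_eq_zero (hE : E.IsSpectralMeasureOf U) {f h : H}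
    {s : Set Circle} (hs : MeasurableSet s) (hf : E.proj s f = f) (hh : E.proj sᶜ h = h) :
    ⟪f, U h⟫_ℂ = 0 ∧ ⟪h, U f⟫_ℂ = 0 := by
  have key : ∀ a : ℂ, ‖a‖ = 1 → a * ⟪f, U h⟫_ℂ + conj a * ⟪h, U f⟫_ℂ = 0 := by
    intro a ha
    have h1 := hE ((1 : ℂ) • f + a • h)
    rw [E.scalarMeasure_smul_add_smul hs hf hh, ha] at h1
    simp only [norm_one, one_pow, ENNReal.ofReal_one, one_smul] at h1
    rw [integral_add_measure (integrable_circle_of_continuous _ continuous_subtype_val)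
      (integrable_circle_of_continuous _ continuous_subtype_val), hE f, hE h] at h1
    simp only [map_add, map_smul, inner_add_left, inner_add_right, inner_smul_left,
      inner_smul_right] at h1
    have h2 : conj a * a = 1 := by
      rw [mul_comm, Complex.mul_conj, Complex.normSq_eq_norm_sq, ha]; simp
    linear_combination -h1 - ⟪h, U h⟫_ℂ * h2
  have h1 := key 1 (by simp)
  have h2 := key Complex.I (by simp)
  simp only [map_one, one_mul, Complex.conj_I] at h1 h2
  constructor
  · linear_combination (1 / 2) * h1 - Complex.I / 2 * h2
      + (⟪f, U h⟫_ℂ / 2 - ⟪h, U f⟫_ℂ / 2) * Complex.I_mul_I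
  · linear_combination (1 / 2) * h1 + Complex.I / 2 * h2
      - (⟪f, U h⟫_ℂ / 2 - ⟪h, U f⟫_ℂ / 2) * Complex.I_mul_I

theorem proj_add_proj_compl (E : ProjectionValuedMeasure H) {s : Set Circle}
    (hs : MeasurableSet s) (f : H) : E.proj s f + E.proj sᶜ f = f := by
  rw [← E.proj_union hs hs.compl disjoint_compl_right, Set.union_compl_self, E.proj_univ]
  rfl

/-- By the preceding orthogonality `U` leaves the range of each `E(t)` invariant. Using this for `s`
and for `sᶜ` gives commutation. -/
theorem IsSpectralMeasureOf.proj_map (hE : E.IsSpectralMeasureOf U) {s : Set Circle}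
    (hs : MeasurableSet s) (f : H) : E.proj s (U f) = U (E.proj s f) := by
  have key : ∀ (t : Set Circle), MeasurableSet t → E.proj tᶜ (U (E.proj t f)) = 0 := by
    intro t ht
    refine ext_inner_left ℂ fun v => ?_
    rw [← E.inner_proj_left ht.compl, inner_zero_right]
    exact (hE.inner_eq_zero ht (E.proj_proj_self ht f) (E.proj_proj_self ht.compl v)).2
  have h1 : E.proj s (U f) = E.proj s (U (E.proj s f)) := by
    conv_lhs => rw [← E.proj_add_proj_compl hs f, map_add, map_add]
    have := key sᶜ hs.compl
    rw [compl_compl] at this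
    rw [this, add_zero]
  have h2 := E.proj_add_proj_compl hs (U (E.proj s f))
  rw [key s hs, add_zero] at h2
  rw [h1, h2]

theorem IsSpectralMeasureOf.setIntegral (hE : E.IsSpectralMeasureOf U) {s : Set Circle}
    (hs : MeasurableSet s) (f : H) :
    ∫ z in s, (z : ℂ) ∂(E.scalarMeasure f) = ⟪f, E.proj s (U f)⟫_ℂ := by
  rw [← E.scalarMeasure_proj f hs, hE, ← hE.proj_map hs, E.inner_proj_left hs,
    E.proj_proj_self hs]

theorem two_add_two_mul_re_nonneg (z : Circle) : 0 ≤ 2 + 2 * (z : ℂ).re := by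
  have h := Complex.abs_re_le_norm (z : ℂ)
  rw [Circle.norm_coe] at h
  linarith [neg_le_of_abs_le h]

/-- The density of the measure of `f + U f` with respect to that of `f`. -/
theorem IsSpectralMeasureOf.scalarMeasure_add_map (hE : E.IsSpectralMeasureOf U) (f : H) :
    E.scalarMeasure (f + U f) = (E.scalarMeasure f).withDensity
      (fun z => ENNReal.ofReal (2 + 2 * (z : ℂ).re)) := by
  have hc : Continuous fun z : Circle => 2 + 2 * (z : ℂ).re := by fun_prop
  ext s hs
  rw [withDensity_apply _ hs, ← ofReal_integral_eq_lintegral_ofReal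
    (integrable_circle_of_continuous _ hc) (Eventually.of_forall two_add_two_mul_re_nonneg),
    E.scalarMeasure_apply_eq_norm_sq _ hs]
  congr 1
  have hz : Integrable (fun z : Circle => (z : ℂ)) ((E.scalarMeasure f).restrict s) :=
    integrable_circle_of_continuous _ (by fun_prop)
  have hre : ∫ z in s, (z : ℂ).re ∂(E.scalarMeasure f) = (⟪f, E.proj s (U f)⟫_ℂ).re := by
    rw [← hE.setIntegral hs]
    exact integral_re hz
  have hsplit : ∫ z in s, (2 + 2 * (z : ℂ).re) ∂(E.scalarMeasure f)
      = ∫ _ in s, (2 : ℝ) ∂(E.scalarMeasure f)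
        + 2 * ∫ z in s, (z : ℂ).re ∂(E.scalarMeasure f) := by
    rw [← integral_const_mul]
    exact integral_add (integrable_const _) (hz.re.const_mul 2)
  have h3 : (E.scalarMeasure f).real s = ‖E.proj s f‖ ^ 2 := by
    rw [Measure.real, E.scalarMeasure_apply_eq_norm_sq _ hs, ENNReal.toReal_ofReal (by positivity)]
  have h4 : ⟪f, U (E.proj s f)⟫_ℂ = ⟪E.proj s f, U (E.proj s f)⟫_ℂ := by
    rw [E.inner_proj_left hs, hE.proj_map hs, E.proj_proj_self hs]
  -- Both sides equal `2‖E(s)f‖² + 2 Re ⟪E(s)f, U E(s)f⟫`; the density is `|1 + z|²`.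
  rw [hsplit, hre, map_add, hE.proj_map hs, setIntegral_const, h3, h4, smul_eq_mul,
    @norm_add_sq ℂ, LinearIsometryEquiv.norm_map]
  change _ + 2 * (_ : ℂ).re + _ = _
  ring

/-- The definition prescribes only the first moment. The others follow by induction: on the circle
`|1 + z|² z^(n+1) = z^n + 2 z^(n+1) + z^(n+2)`, so the moment of order `n + 1` of `f + U f` contains
the moment of order `n + 2` of `f` together with lower ones, and `⟪f + U f, U^(n+1) (f + U f)⟫`
expands in the same way. -/
theorem IsSpectralMeasureOf.integral_pow (hE : E.IsSpectralMeasureOf U) (n : ℕ) (f : H) :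
    ∫ z : Circle, (z : ℂ) ^ n ∂(E.scalarMeasure f) = ⟪f, U^[n] f⟫_ℂ := by
  induction n using Nat.strong_induction_on generalizing f with
  | _ n ih =>
  match n with
  | 0 =>
    simp only [pow_zero, Function.iterate_zero, id]
    rw [integral_const, Measure.real, E.scalarMeasure_apply_eq_norm_sq f MeasurableSet.univ,
      E.proj_univ, ENNReal.toReal_ofReal (by positivity)]
    simp [inner_self_eq_norm_sq_to_K]
  | 1 => simpa using hE f
  | (n + 2) =>
    have hadd : ∀ (k : ℕ) (x y : H), U^[k] (x + y) = U^[k] x + U^[k] y := fun k x y =>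
      Function.Semiconj₂.iterate (f := U) (op := (· + ·)) (fun x y => map_add U x y) k x y
    have h1 := ih (n + 1) (by omega) (f + U f)
    have hd : ∀ z : Circle, (ENNReal.ofReal (2 + 2 * (z : ℂ).re)).toReal • (z : ℂ) ^ (n + 1)
        = 2 * (z : ℂ) ^ (n + 1) + (z : ℂ) ^ (n + 2) + (z : ℂ) ^ n := by
      intro z
      rw [ENNReal.toReal_ofReal (two_add_two_mul_re_nonneg z), Complex.real_smul]
      have h2 : ((2 + 2 * (z : ℂ).re : ℝ) : ℂ) = 2 + (z + conj (z : ℂ)) := by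
        rw [Complex.add_conj]; push_cast; ring
      have h3 : (z : ℂ) * conj (z : ℂ) = 1 := by
        rw [Complex.mul_conj, Complex.normSq_eq_norm_sq, Circle.norm_coe]; simp
      rw [h2]
      linear_combination (z : ℂ) ^ n * h3
    rw [hE.scalarMeasure_add_map f, integral_withDensity_eq_integral_toReal_smul
      (by fun_prop) (Eventually.of_forall fun _ => ENNReal.ofReal_lt_top)] at h1
    simp only [hd] at h1
    rw [integral_add, integral_add, integral_const_mul,
      ih (n + 1) (by omega) f, ih n (by omega) f] at h1
    rotate_left
    iterate 4 exact integrable_circle_of_continuous _ (by fun_prop)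
    rw [hadd, inner_add_left, inner_add_right, inner_add_right] at h1
    have e1 : U^[n + 1] (U f) = U^[n + 2] f := rfl
    have e2 : ⟪U f, U^[n + 1] f⟫_ℂ = ⟪f, U^[n] f⟫_ℂ := by
      rw [Function.iterate_succ_apply', U.inner_map_map]
    have e3 : ⟪U f, U^[n + 1] (U f)⟫_ℂ = ⟪f, U^[n + 1] f⟫_ℂ := by
      rw [Function.iterate_succ_apply', U.inner_map_map]; rfl
    rw [e2, e3, e1] at h1
    linear_combination h1

end ProjectionValuedMeasure

theorem isProbabilityMeasure_scalarSpectralMeasure (K : H →ₗᵢ[ℂ] H) {g : H} (hg : ‖g‖ = 1) :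
    IsProbabilityMeasure (scalarSpectralMeasure K g) := by
  obtain ⟨H', _, _, _, ι, U, E', -, -, h⟩ := scalarSpectralMeasure_spec K g
  rw [h]
  exact E'.isProbabilityMeasure_scalarMeasure (by rw [ι.norm_map, hg])

/-- The unitary extension behind the measure is an arbitrary choice; the moments do not see it
because `U^n` extends `K^n`. -/
theorem integral_pow_scalarSpectralMeasure (K : H →ₗᵢ[ℂ] H) (g : H) (n : ℕ) :
    ∫ z : Circle, (z : ℂ) ^ n ∂(scalarSpectralMeasure K g) = ⟪g, K^[n] g⟫_ℂ := by
  obtain ⟨H', _, _, _, ι, U, E', hU, hE, h⟩ := scalarSpectralMeasure_spec K g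
  have hit : U^[n] (ι g) = ι (K^[n] g) := by
    induction n with
    | zero => rfl
    | succ n ih => rw [Function.iterate_succ_apply', ih, hU, ← Function.iterate_succ_apply' K]
  rw [h, hE.integral_pow, hit, ι.inner_map_map]

end SpectralMoments

/-! ### The Wasserstein distance on the circle and its control by moments. -/

section Wasserstein

theorem Circle.dist_eq (z z' : Circle) : dist z z' = ‖(z : ℂ) - z'‖ :=
  Complex.dist_eq _ _

theorem Circle.coe_mul_conj (z : Circle) : (z : ℂ) * conj (z : ℂ) = 1 := by
  rw [Complex.mul_conj, Complex.normSq_eq_norm_sq, Circle.norm_coe]; simp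

theorem sum_pow_mul_conj_pow {n : ℕ} {ζ : Circle} (hζ : IsPrimitiveRoot (ζ : ℂ) n) {j k : ℕ}
    (hj : j < n) (hk : k < n) :
    ∑ t ∈ Finset.range n, ((ζ : ℂ) ^ t) ^ j * conj (((ζ : ℂ) ^ t) ^ k)
      = if j = k then (n : ℂ) else 0 := by
  have h1 : ∀ t, ((ζ : ℂ) ^ t) ^ j * conj (((ζ : ℂ) ^ t) ^ k)
      = ((ζ : ℂ) ^ j * conj (ζ : ℂ) ^ k) ^ t := by
    intro t
    simp only [map_pow, mul_pow, ← pow_mul]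
    rw [mul_comm t j, mul_comm t k]
  have hone : ∀ i : ℕ, (ζ : ℂ) ^ i * conj (ζ : ℂ) ^ i = 1 := fun i => by
    rw [← mul_pow, Circle.coe_mul_conj, one_pow]
  simp only [h1]
  split_ifs with hjk
  · subst hjk
    simp [hone]
  · set x : ℂ := (ζ : ℂ) ^ j * conj (ζ : ℂ) ^ k with hx
    have hxn : x ^ n = 1 := by
      rw [hx, mul_pow, ← pow_mul, ← pow_mul, mul_comm j, mul_comm k, pow_mul, pow_mul, ← map_pow,
        hζ.pow_eq_one]
      simp
    have hx1 : x ≠ 1 := by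
      intro h
      refine hjk (hζ.pow_inj hj hk ?_)
      calc (ζ : ℂ) ^ j = x * (ζ : ℂ) ^ k := by
            rw [hx, mul_assoc, mul_comm (conj (ζ : ℂ) ^ k), hone, mul_one]
        _ = (ζ : ℂ) ^ k := by rw [h, one_mul]
    have := geom_sum_mul x n
    rw [hxn, sub_self] at this
    exact (mul_eq_zero.mp this).resolve_right (sub_ne_zero.mpr hx1)

/-- Parseval's identity for a trigonometric sum sampled at the rotated roots of unity. -/
theorem sum_norm_sq_trigSum {n : ℕ} {ζ : Circle} (hζ : IsPrimitiveRoot (ζ : ℂ) n) (a : ℕ → ℂ)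
    (w : Circle) :
    ∑ t ∈ Finset.range n, ‖∑ k ∈ Finset.range n, a k * ((w : ℂ) * (ζ : ℂ) ^ t) ^ k‖ ^ 2
      = n * ∑ k ∈ Finset.range n, ‖a k‖ ^ 2 := by
  rw [← Complex.ofReal_inj]
  push_cast
  simp only [← Complex.mul_conj', map_sum, Finset.sum_mul_sum, map_mul, map_pow]
  rw [Finset.sum_comm, Finset.mul_sum]
  refine Finset.sum_congr rfl fun j hj => ?_
  rw [Finset.sum_comm]
  have h1 : ∀ k ∈ Finset.range n, ∑ t ∈ Finset.range n,
      a j * ((w : ℂ) * (ζ : ℂ) ^ t) ^ j * (conj (a k) * (conj (w : ℂ) * conj (ζ : ℂ) ^ t) ^ k)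
      = if j = k then (n : ℂ) * (a j * conj (a j)) else 0 := by
    intro k hk
    have h2 := sum_pow_mul_conj_pow hζ (Finset.mem_range.mp hj) (Finset.mem_range.mp hk)
    have h3 : ∀ t, a j * ((w : ℂ) * (ζ : ℂ) ^ t) ^ j
        * (conj (a k) * (conj (w : ℂ) * conj (ζ : ℂ) ^ t) ^ k)
        = (a j * conj (a k) * ((w : ℂ) ^ j * conj (w : ℂ) ^ k))
          * (((ζ : ℂ) ^ t) ^ j * conj (((ζ : ℂ) ^ t) ^ k)) := by
      intro t
      simp only [mul_pow, map_pow]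
      ring
    simp only [h3]
    rw [← Finset.mul_sum, h2]
    split_ifs with hjk
    · subst hjk
      rw [← mul_pow, Circle.coe_mul_conj, one_pow]
      ring
    · simp
  rw [Finset.sum_congr rfl h1, Finset.sum_ite_eq, if_pos hj]

theorem exists_isPrimitiveRoot_circle {n : ℕ} (hn : n ≠ 0) :
    ∃ ζ : Circle, IsPrimitiveRoot (ζ : ℂ) n := by
  refine ⟨Circle.exp (2 * Real.pi / n), ?_⟩
  have h := Complex.isPrimitiveRoot_exp n hn
  convert h using 1
  rw [Circle.coe_exp]
  congr 1
  push_cast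
  ring

/-- Expanding the square leaves only the products `z^j conj(z)^k`, which on the circle are powers of
order `|j - k| < n` or their conjugates. The absolute values of the coefficients add up to `(∑ ‖a
k‖)²`. -/
theorem norm_integral_norm_sq_trigSum_sub_le {μ ν : Measure Circle} [IsProbabilityMeasure μ]
    [IsProbabilityMeasure ν] {n : ℕ} {δ : ℝ}
    (hδ : ∀ l < n, ‖∫ z : Circle, (z : ℂ) ^ l ∂μ - ∫ z : Circle, (z : ℂ) ^ l ∂ν‖ ≤ δ)
    (a : ℕ → ℂ) (c : Circle) :
    |∫ z : Circle, ‖∑ k ∈ Finset.range n, a k * ((z : ℂ) * (c : ℂ)) ^ k‖ ^ 2 ∂μ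
      - ∫ z : Circle, ‖∑ k ∈ Finset.range n, a k * ((z : ℂ) * (c : ℂ)) ^ k‖ ^ 2 ∂ν|
      ≤ (∑ k ∈ Finset.range n, ‖a k‖) ^ 2 * δ := by
  have hmom : ∀ j < n, ∀ k < n, ‖∫ z : Circle, (z : ℂ) ^ j * conj (z : ℂ) ^ k ∂μ
      - ∫ z : Circle, (z : ℂ) ^ j * conj (z : ℂ) ^ k ∂ν‖ ≤ δ := by
    have h0 : ∀ j < n, ∀ k ≤ j, ‖∫ z : Circle, (z : ℂ) ^ j * conj (z : ℂ) ^ k ∂μ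
      - ∫ z : Circle, (z : ℂ) ^ j * conj (z : ℂ) ^ k ∂ν‖ ≤ δ := by
      intro j hj k hk
      have h1 : ∀ z : Circle, (z : ℂ) ^ j * conj (z : ℂ) ^ k = (z : ℂ) ^ (j - k) := by
        intro z
        obtain ⟨i, rfl⟩ := Nat.exists_eq_add_of_le hk
        rw [Nat.add_sub_cancel_left, pow_add, mul_right_comm, ← mul_pow, Circle.coe_mul_conj,
          one_pow, one_mul]
      simp only [h1]
      exact hδ _ (by omega)
    intro j hj k hk
    rcases le_total k j with h | h
    · exact h0 j hj k h
    · have h1 : ∀ z : Circle, (z : ℂ) ^ j * conj (z : ℂ) ^ k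
          = conj ((z : ℂ) ^ k * conj (z : ℂ) ^ j) := by
        intro z; simp [mul_comm]
      simp only [h1]
      rw [integral_conj, integral_conj, ← map_sub, RCLike.norm_conj]
      exact h0 k hk j h
  have hexp : ∀ (ρ : Measure Circle) [IsProbabilityMeasure ρ],
      ((∫ z : Circle, ‖∑ k ∈ Finset.range n, a k * ((z : ℂ) * (c : ℂ)) ^ k‖ ^ 2 ∂ρ : ℝ) : ℂ)
      = ∑ j ∈ Finset.range n, ∑ k ∈ Finset.range n,
          (a j * (c : ℂ) ^ j * (conj (a k) * conj (c : ℂ) ^ k))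
            * ∫ z : Circle, (z : ℂ) ^ j * conj (z : ℂ) ^ k ∂ρ := by
    intro ρ _
    have h1 : ∀ z : Circle,
        ((‖∑ k ∈ Finset.range n, a k * ((z : ℂ) * (c : ℂ)) ^ k‖ ^ 2 : ℝ) : ℂ)
        = ∑ j ∈ Finset.range n, ∑ k ∈ Finset.range n,
          (a j * (c : ℂ) ^ j * (conj (a k) * conj (c : ℂ) ^ k))
            * ((z : ℂ) ^ j * conj (z : ℂ) ^ k) := by
      intro z
      push_cast
      simp only [← Complex.mul_conj', map_sum, Finset.sum_mul_sum, map_mul, map_pow]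
      refine Finset.sum_congr rfl fun j _ => Finset.sum_congr rfl fun k _ => ?_
      ring
    have h2 : ∀ j k : ℕ, Integrable (fun z : Circle =>
        (a j * (c : ℂ) ^ j * (conj (a k) * conj (c : ℂ) ^ k))
          * ((z : ℂ) ^ j * conj (z : ℂ) ^ k)) ρ := fun j k =>
      integrable_circle_of_continuous _ (by fun_prop)
    refine (integral_ofReal (𝕜 := ℂ)).symm.trans ?_
    calc _ = ∫ z : Circle, ∑ j ∈ Finset.range n, ∑ k ∈ Finset.range n,
          (a j * (c : ℂ) ^ j * (conj (a k) * conj (c : ℂ) ^ k))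
            * ((z : ℂ) ^ j * conj (z : ℂ) ^ k) ∂ρ := integral_congr_ae (Eventually.of_forall h1)
      _ = _ := by
        rw [integral_finsetSum _ fun j _ => integrable_finsetSum _ fun k _ => h2 j k]
        refine Finset.sum_congr rfl fun j _ => ?_
        rw [integral_finsetSum _ fun k _ => h2 j k]
        exact Finset.sum_congr rfl fun k _ => integral_const_mul _ _
  rw [← Real.norm_eq_abs, ← Complex.norm_real, Complex.ofReal_sub, hexp, hexp,
    ← Finset.sum_sub_distrib, sq, Finset.sum_mul_sum, Finset.sum_mul]
  refine (norm_sum_le _ _).trans (Finset.sum_le_sum fun j hj => ?_)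
  rw [← Finset.sum_sub_distrib, Finset.sum_mul]
  refine (norm_sum_le _ _).trans (Finset.sum_le_sum fun k hk => ?_)
  rw [← mul_sub, norm_mul]
  have h3 : ‖a j * (c : ℂ) ^ j * (conj (a k) * conj (c : ℂ) ^ k)‖ = ‖a j‖ * ‖a k‖ := by
    simp only [norm_mul, norm_pow, RCLike.norm_conj, Circle.norm_coe, one_pow, mul_one]
  rw [h3]
  exact mul_le_mul_of_nonneg_left (hmom j (Finset.mem_range.mp hj) k (Finset.mem_range.mp hk))
    (by positivity)

/-- The trigonometric sum `(1 + z + ⋯ + z^(m-1))²`, by its coefficients. -/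
theorem exists_coeff_sq_geom_sum {m : ℕ} (hm : 1 ≤ m) :
    ∃ a : ℕ → ℂ, ∀ z : ℂ, ∑ k ∈ Finset.range (2 * m - 1), a k * z ^ k
      = (∑ k ∈ Finset.range m, z ^ k) ^ 2 := by
  let p : Polynomial ℂ := (∑ k ∈ Finset.range m, Polynomial.X ^ k) ^ 2
  refine ⟨p.coeff, fun z => ?_⟩
  have hdeg : p.natDegree < 2 * m - 1 := by
    have h1 : (∑ k ∈ Finset.range m, (Polynomial.X : Polynomial ℂ) ^ k).natDegree ≤ m - 1 := by
      refine Polynomial.natDegree_sum_le_of_forall_le _ _ fun k hk => ?_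
      rw [Polynomial.natDegree_X_pow]
      have := Finset.mem_range.mp hk
      omega
    have h2 := Polynomial.natDegree_pow_le_of_le 2 h1
    have : p.natDegree ≤ 2 * (m - 1) := h2
    omega
  rw [← Polynomial.eval_eq_sum_range' hdeg]
  simp [p, Polynomial.eval_finsetSum]

/-- Two probability measures on the circle whose first moments are close are close in the
Wasserstein distance. The proof tests against a discrete Jackson kernel. -/
theorem wassersteinOne_le_of_moments {μ ν : Measure Circle} [IsProbabilityMeasure μ]
    [IsProbabilityMeasure ν] {m : ℕ} (hm : 1 ≤ m) {δ : ℝ}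
    (hδ : ∀ l < 2 * m - 1, ‖∫ z : Circle, (z : ℂ) ^ l ∂μ - ∫ z : Circle, (z : ℂ) ^ l ∂ν‖ ≤ δ) :
    wassersteinOne μ ν ≤ ENNReal.ofReal (9 / m + 4 * m * δ) := by
  have hδ0 : 0 ≤ δ := (norm_nonneg _).trans (hδ 0 (by omega))
  have hm0 : (0 : ℝ) < m := by exact_mod_cast hm
  obtain ⟨a, ha⟩ := exists_coeff_sq_geom_sum hm
  -- With `D = 1 + z + ⋯ + z^(m-1)`, the square `D²` has degree `2m - 2 < n`, so Parseval's identity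
  -- at the `n`-th roots of unity is exact for it.
  set n := 2 * m - 1 with hn
  have hn2 : (n : ℝ) ≤ 2 * m := by
    have : n ≤ 2 * m := by omega
    exact_mod_cast this
  obtain ⟨ζ, hζ⟩ := exists_isPrimitiveRoot_circle (n := n) (by omega)
  set Z : ℝ := n * ∑ k ∈ Finset.range n, ‖a k‖ ^ 2 with hZ
  have hZA : (∑ k ∈ Finset.range n, ‖a k‖) ^ 2 ≤ Z := by
    have := sq_sum_le_card_mul_sum_sq (s := Finset.range n) (f := fun k => ‖a k‖)
    rwa [Finset.card_range] at this
  -- The coefficients of `D²` add up to `D(1)² = m²`.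
  have hZm : (m : ℝ) ^ 4 ≤ Z := by
    refine le_trans ?_ hZA
    have h1 := ha 1
    simp only [one_pow, mul_one, Finset.sum_const, Finset.card_range, nsmul_eq_mul] at h1
    have h2 : (m : ℝ) ^ 2 ≤ ∑ k ∈ Finset.range n, ‖a k‖ := by
      refine le_trans (le_of_eq ?_) (norm_sum_le _ _)
      rw [h1]; simp
    calc (m : ℝ) ^ 4 = ((m : ℝ) ^ 2) ^ 2 := by ring
      _ ≤ _ := pow_le_pow_left₀ (by positivity) h2 2
  have hZ0 : 0 < Z := lt_of_lt_of_le (by positivity) hZm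
  -- The kernel `|D(w ζ^t)|⁴ / Z`: by Parseval a partition of unity in `t`, concentrated where `w`
  -- is close to `ζ^(-t)`.
  let κ : ℕ → Circle → ℝ := fun t w =>
    ‖∑ k ∈ Finset.range n, a k * ((w : ℂ) * ((ζ ^ t : Circle) : ℂ)) ^ k‖ ^ 2 / Z
  have hκ0 : ∀ t w, 0 ≤ κ t w := fun t w => by positivity
  have hκc : ∀ t, Continuous (κ t) := fun t => by fun_prop
  have hκ1 : ∀ w, ∑ t ∈ Finset.range n, κ t w = 1 := by
    intro w
    have := sum_norm_sq_trigSum hζ a w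
    rw [← Finset.sum_div]
    simp only [Circle.coe_pow]
    rw [this, div_self hZ0.ne']
  -- Since `(u - 1) D(u) = u^m - 1` has modulus at most `2`, the factor `|u - 1|²` turns `|D|⁴` into
  -- at most `4|D|²`, and Parseval for `D` itself gives the sum `n m ≤ 2m²`.
  have hκ2 : ∀ w : Circle, ∑ t ∈ Finset.range n, ‖(w : ℂ) * ((ζ ^ t : Circle) : ℂ) - 1‖ ^ 2 * κ t w
      ≤ 8 / (m : ℝ) ^ 2 := by
    intro w
    have hD := sum_norm_sq_trigSum hζ (fun k => if k < m then 1 else 0) w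
    have hD1 : ∀ z : ℂ, ∑ k ∈ Finset.range n, (if k < m then (1 : ℂ) else 0) * z ^ k
        = ∑ k ∈ Finset.range m, z ^ k := by
      intro z
      simp only [ite_mul, one_mul, zero_mul]
      rw [← Finset.sum_filter]
      congr 1
      ext k
      simp only [Finset.mem_filter, Finset.mem_range]
      omega
    have hD2 : ∑ k ∈ Finset.range n, ‖(if k < m then (1 : ℂ) else 0)‖ ^ 2 = m := by
      have : ∀ k, ‖(if k < m then (1 : ℂ) else 0)‖ ^ 2 = if k < m then (1 : ℝ) else 0 := by
        intro k; split_ifs <;> simp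
      simp only [this]
      rw [← Finset.sum_filter, Finset.sum_const, nsmul_eq_mul, mul_one]
      have : (Finset.range n).filter (· < m) = Finset.range m := by
        ext k
        simp only [Finset.mem_filter, Finset.mem_range]
        omega
      rw [this, Finset.card_range]
    simp only [hD1, hD2] at hD
    have hterm : ∀ t ∈ Finset.range n, ‖(w : ℂ) * ((ζ ^ t : Circle) : ℂ) - 1‖ ^ 2 * κ t w
        ≤ 4 / Z * ‖∑ k ∈ Finset.range m, ((w : ℂ) * (ζ : ℂ) ^ t) ^ k‖ ^ 2 := by
      intro t _
      simp only [κ, ha, Circle.coe_pow]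
      set u : ℂ := (w : ℂ) * (ζ : ℂ) ^ t with hu
      have hun : ‖u‖ = 1 := by
        rw [hu, norm_mul, norm_pow, Circle.norm_coe, Circle.norm_coe]; simp
      have h1 : ‖u - 1‖ * ‖∑ k ∈ Finset.range m, u ^ k‖ ≤ 2 := by
        rw [mul_comm, ← norm_mul, geom_sum_mul]
        refine (norm_sub_le _ _).trans ?_
        rw [norm_pow, hun]; norm_num
      set d := ‖∑ k ∈ Finset.range m, u ^ k‖ with hd
      have h2 : (‖u - 1‖ * d) ^ 2 ≤ 4 := by
        calc (‖u - 1‖ * d) ^ 2 ≤ 2 ^ 2 := pow_le_pow_left₀ (by positivity) h1 2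
          _ = 4 := by norm_num
      rw [norm_pow, ← hd]
      calc ‖u - 1‖ ^ 2 * ((d ^ 2) ^ 2 / Z) = (‖u - 1‖ * d) ^ 2 * (d ^ 2 / Z) := by ring
        _ ≤ 4 * (d ^ 2 / Z) := mul_le_mul_of_nonneg_right h2 (by positivity)
        _ = 4 / Z * d ^ 2 := by ring
    refine (Finset.sum_le_sum hterm).trans ?_
    rw [← Finset.mul_sum, hD, div_mul_eq_mul_div, div_le_div_iff₀ hZ0 (by positivity)]
    calc 4 * ((n : ℝ) * m) * (m : ℝ) ^ 2 ≤ 4 * ((2 * m) * m) * (m : ℝ) ^ 2 := by gcongr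
      _ = 8 * (m : ℝ) ^ 4 := by ring
      _ ≤ 8 * Z := by gcongr
  have hκ3 : ∀ w : Circle, ∑ t ∈ Finset.range n, ‖(w : ℂ) * ((ζ ^ t : Circle) : ℂ) - 1‖ * κ t w
      ≤ 9 / 2 / m := by
    intro w
    have h1 : ∀ t ∈ Finset.range n, ‖(w : ℂ) * ((ζ ^ t : Circle) : ℂ) - 1‖ * κ t w
        ≤ m / 2 * (‖(w : ℂ) * ((ζ ^ t : Circle) : ℂ) - 1‖ ^ 2 * κ t w) + 1 / (2 * m) * κ t w := by
      intro t _
      set b := ‖(w : ℂ) * ((ζ ^ t : Circle) : ℂ) - 1‖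
      -- The weight balances the two terms: the second moment `8/m²` contributes `4/m` and the total
      -- mass `1/(2m)`.
      have h2 : b ≤ m / 2 * b ^ 2 + 1 / (2 * m) := by
        have h3 : m / 2 * b ^ 2 + 1 / (2 * m) - b = (m * b - 1) ^ 2 / (2 * m) := by
          field_simp; ring
        have h4 : 0 ≤ (m * b - 1) ^ 2 / (2 * m) := by positivity
        linarith
      calc b * κ t w ≤ (m / 2 * b ^ 2 + 1 / (2 * m)) * κ t w :=
            mul_le_mul_of_nonneg_right h2 (hκ0 t w)
        _ = _ := by ring
    refine (Finset.sum_le_sum h1).trans ?_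
    rw [Finset.sum_add_distrib, ← Finset.mul_sum, ← Finset.mul_sum, hκ1]
    calc _ ≤ m / 2 * (8 / (m : ℝ) ^ 2) + 1 / (2 * m) * 1 := by
          have := hκ2 w
          gcongr
      _ = 9 / 2 / m := by field_simp; ring
  refine iSup₂_le fun φ hφ => ENNReal.ofReal_le_ofReal ?_
  have hint : ∀ (ρ : Measure Circle) [IsProbabilityMeasure ρ], Integrable φ ρ := fun ρ _ =>
    integrable_circle_of_continuous ρ hφ.continuous
  -- Subtracting a constant does not affect the difference of integrals and makes the test function
  -- bounded by the diameter `2`.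
  let χ : Circle → ℝ := fun z => φ z - φ 1
  have hdist : ∀ z z' : Circle, |φ z - φ z'| ≤ ‖(z : ℂ) - z'‖ := by
    intro z z'
    have := hφ.dist_le_mul z z'
    rwa [NNReal.coe_one, one_mul, Real.dist_eq, Circle.dist_eq] at this
  have hχ2 : ∀ z, |χ z| ≤ 2 := by
    intro z
    refine (hdist z 1).trans ((norm_sub_le _ _).trans ?_)
    rw [Circle.norm_coe, Circle.norm_coe]; norm_num
  have hχc : Continuous χ := hφ.continuous.sub continuous_const
  let P : Circle → ℝ := fun w => ∑ t ∈ Finset.range n, χ (ζ ^ t)⁻¹ * κ t w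
  have hPc : Continuous P := by
    refine continuous_finsetSum _ fun t _ => continuous_const.mul (hκc t)
  have hclose : ∀ w, |χ w - P w| ≤ 9 / 2 / m := by
    intro w
    refine le_trans ?_ (hκ3 w)
    have h1 : χ w - P w = ∑ t ∈ Finset.range n, (χ w - χ (ζ ^ t)⁻¹) * κ t w := by
      simp only [sub_mul, Finset.sum_sub_distrib, ← Finset.mul_sum, hκ1, mul_one, P]
    rw [h1]
    refine (Finset.abs_sum_le_sum_abs _ _).trans (Finset.sum_le_sum fun t _ => ?_)
    rw [abs_mul, abs_of_nonneg (hκ0 t w)]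
    refine mul_le_mul_of_nonneg_right ?_ (hκ0 t w)
    have h2 : χ w - χ (ζ ^ t)⁻¹ = φ w - φ (ζ ^ t)⁻¹ := by simp only [χ]; ring
    rw [h2]
    refine (hdist _ _).trans (le_of_eq ?_)
    have h3 : (w : ℂ) * ((ζ ^ t : Circle) : ℂ) - 1
        = ((w : ℂ) - (((ζ ^ t)⁻¹ : Circle) : ℂ)) * ((ζ ^ t : Circle) : ℂ) := by
      rw [sub_mul, Circle.coe_inv, inv_mul_cancel₀ (Circle.coe_ne_zero _)]
    rw [h3, norm_mul, Circle.norm_coe (ζ ^ t), mul_one]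
  have hintP : ∀ (ρ : Measure Circle) [IsProbabilityMeasure ρ],
      |∫ z, χ z ∂ρ - ∫ z, P z ∂ρ| ≤ 9 / 2 / m := by
    intro ρ _
    rw [← integral_sub (integrable_circle_of_continuous ρ hχc)
      (integrable_circle_of_continuous ρ hPc), ← Real.norm_eq_abs]
    have := norm_integral_le_of_norm_le_const (μ := ρ) (f := fun z => χ z - P z)
      (C := 9 / 2 / m) (Eventually.of_forall hclose)
    simpa using this
  -- There are `n ≤ 2m` terms. Each costs at most `2δ`, because the coefficient sum `(∑ ‖a k‖)²` is
  -- absorbed by the normalization `Z`.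
  have hPdiff : |∫ z, P z ∂μ - ∫ z, P z ∂ν| ≤ 4 * m * δ := by
    have hsum : ∀ (ρ : Measure Circle) [IsProbabilityMeasure ρ],
        ∫ z, P z ∂ρ = ∑ t ∈ Finset.range n, χ (ζ ^ t)⁻¹ * ∫ z, κ t z ∂ρ := by
      intro ρ _
      simp only [P]
      rw [integral_finsetSum _ fun t _ =>
        (integrable_circle_of_continuous ρ (hκc t)).const_mul _]
      exact Finset.sum_congr rfl fun t _ => integral_const_mul _ _
    rw [hsum, hsum, ← Finset.sum_sub_distrib]
    have hterm : ∀ t ∈ Finset.range n,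
        |χ (ζ ^ t)⁻¹ * ∫ z, κ t z ∂μ - χ (ζ ^ t)⁻¹ * ∫ z, κ t z ∂ν| ≤ 2 * δ := by
      intro t _
      rw [← mul_sub, abs_mul]
      refine mul_le_mul (hχ2 _) ?_ (abs_nonneg _) (by norm_num)
      simp only [κ]
      rw [integral_div, integral_div, ← sub_div, abs_div, abs_of_pos hZ0, div_le_iff₀ hZ0]
      refine (norm_integral_norm_sq_trigSum_sub_le hδ a (ζ ^ t)).trans ?_
      rw [mul_comm]
      exact mul_le_mul_of_nonneg_left hZA hδ0
    refine (Finset.abs_sum_le_sum_abs _ _).trans ((Finset.sum_le_sum hterm).trans ?_)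
    rw [Finset.sum_const, Finset.card_range, nsmul_eq_mul]
    calc (n : ℝ) * (2 * δ) ≤ (2 * m) * (2 * δ) := by gcongr
      _ = 4 * m * δ := by ring
  have hχφ : ∀ (ρ : Measure Circle) [IsProbabilityMeasure ρ],
      ∫ z, χ z ∂ρ = ∫ z, φ z ∂ρ - φ 1 := by
    intro ρ _
    simp only [χ]
    rw [integral_sub (hint ρ) (integrable_const _)]
    simp
  have e1 := hχφ μ
  have e2 := hχφ ν
  have e3 := abs_le.mp (hintP μ)
  have e4 := abs_le.mp (hintP ν)
  have e5 := abs_le.mp hPdiff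
  have e6 : (9 : ℝ) / m = 9 / 2 / m + 9 / 2 / m := by ring
  rw [e6]
  linarith [e3.2, e4.1, e5.2]

theorem wassersteinOne_triangle (μ ν ρ : Measure Circle) :
    wassersteinOne μ ρ ≤ wassersteinOne μ ν + wassersteinOne ν ρ := by
  refine iSup₂_le fun φ hφ => ?_
  calc ENNReal.ofReal (∫ z, φ z ∂μ - ∫ z, φ z ∂ρ)
      = ENNReal.ofReal ((∫ z, φ z ∂μ - ∫ z, φ z ∂ν) + (∫ z, φ z ∂ν - ∫ z, φ z ∂ρ)) := by
        congr 1; ring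
    _ ≤ _ := ENNReal.ofReal_add_le
    _ ≤ _ := add_le_add
        (le_iSup₂ (f := fun (φ : Circle → ℝ) (_ : LipschitzWith 1 φ) =>
          ENNReal.ofReal (∫ z, φ z ∂μ - ∫ z, φ z ∂ν)) φ hφ)
        (le_iSup₂ (f := fun (φ : Circle → ℝ) (_ : LipschitzWith 1 φ) =>
          ENNReal.ofReal (∫ z, φ z ∂ν - ∫ z, φ z ∂ρ)) φ hφ)

/-- Along a sequence of probability measures whose moments all converge, the Wasserstein distance
to a fixed measure converges. -/
theorem tendsto_wassersteinOne_of_moments (μ : Measure Circle) {ν : ℕ → Measure Circle}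
    (hν : ∀ᶠ M in atTop, IsProbabilityMeasure (ν M)) {c : ℕ → ℂ}
    (hc : ∀ l, Tendsto (fun M => ∫ z : Circle, (z : ℂ) ^ l ∂(ν M)) atTop (𝓝 (c l))) :
    Tendsto (fun M => wassersteinOne μ (ν M)) atTop
      (𝓝 (limsup (fun M => wassersteinOne μ (ν M)) atTop)) := by
  refine tendsto_of_le_liminf_of_limsup_le ?_ le_rfl
  refine ENNReal.le_of_forall_pos_le_add fun ε hε _ => ?_
  -- This `m` and `δ = ε / (8m)` make each of the terms `9/m` and `4mδ` at most `ε/2`.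
  obtain ⟨m, hm⟩ := exists_nat_gt (18 / (ε : ℝ))
  have hε' : (0 : ℝ) < ε := hε
  have hm0 : (0 : ℝ) < m := lt_trans (by positivity) hm
  have hm1 : 1 ≤ m := by exact_mod_cast hm0
  set δ : ℝ := ε / (8 * m) with hδdef
  have hδ : 0 < δ := by positivity
  have hev : ∀ᶠ M in atTop, ∀ l < 2 * m - 1,
      ‖∫ z : Circle, (z : ℂ) ^ l ∂(ν M) - c l‖ ≤ δ / 2 := by
    have h1 : ∀ l ∈ Finset.range (2 * m - 1), ∀ᶠ M in atTop,
        ‖∫ z : Circle, (z : ℂ) ^ l ∂(ν M) - c l‖ ≤ δ / 2 := by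
      intro l _
      have := (hc l).sub_const (c l)
      rw [sub_self] at this
      filter_upwards [(Metric.tendsto_nhds.mp this) (δ / 2) (by positivity)] with M hM
      rw [dist_zero_right] at hM
      exact hM.le
    filter_upwards [(Finset.eventually_all _).mpr h1] with M hM l hl
    exact hM l (Finset.mem_range.mpr hl)
  obtain ⟨M₀, hM₀⟩ := eventually_atTop.mp (hev.and hν)
  -- The sequence is Cauchy, which suffices for `limsup ≤ liminf + ε`; no limit measure has to be
  -- constructed.
  have hle : ∀ M ≥ M₀, ∀ M' ≥ M₀, wassersteinOne μ (ν M) ≤ wassersteinOne μ (ν M') + ε := by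
    intro M hM M' hM'
    refine (wassersteinOne_triangle μ (ν M') (ν M)).trans (add_le_add le_rfl ?_)
    have := (hM₀ M hM).2
    have := (hM₀ M' hM').2
    refine (wassersteinOne_le_of_moments hm1 (δ := δ) fun l hl => ?_).trans ?_
    · have h1 := (hM₀ M hM).1 l hl
      have h2 := (hM₀ M' hM').1 l hl
      rw [norm_sub_rev] at h1
      refine (norm_sub_le_norm_sub_add_norm_sub _ (c l) _).trans ?_
      linarith
    · rw [← ENNReal.ofReal_coe_nnreal]
      refine ENNReal.ofReal_le_ofReal ?_
      have h1 : 9 / (m : ℝ) ≤ ε / 2 := by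
        rw [div_lt_iff₀ hε'] at hm
        rw [div_le_iff₀ hm0]
        linarith
      have h2 : 4 * m * δ = ε / 2 := by
        rw [hδdef]; field_simp; ring
      linarith
  have h1 : ∀ M' ≥ M₀, limsup (fun M => wassersteinOne μ (ν M)) atTop
      ≤ wassersteinOne μ (ν M') + ε := fun M' hM' =>
    limsup_le_of_le (by isBoundedDefault)
      (eventually_atTop.mpr ⟨M₀, fun M hM => hle M hM M' hM'⟩)
  rw [← tsub_le_iff_right]
  refine le_liminf_of_le (by isBoundedDefault) (eventually_atTop.mpr ⟨M₀, fun M' hM' => ?_⟩)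
  rw [tsub_le_iff_right]
  exact h1 M' hM'

end Wasserstein

/-! ### Square roots, inverses and polar factors of convergent matrices. -/

section Matrices

open Matrix
open scoped ComplexOrder

variable {N : ℕ}

section L2Operator

open scoped Matrix.Norms.L2Operator

theorem tendsto_sqrt_of_posSemidef {ι : Type*} {l : Filter ι}
    {X : ι → Matrix (Fin N) (Fin N) ℂ} {Y : Matrix (Fin N) (Fin N) ℂ}
    (hX : ∀ᶠ i in l, (X i).PosSemidef) (hY : Y.PosSemidef) (h : Tendsto X l (𝓝 Y)) :
    Tendsto (fun i => CFC.sqrt (X i)) l (𝓝 (CFC.sqrt Y)) := by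
  have h1 : Tendsto X l (𝓝[{a | 0 ≤ a}] Y) :=
    tendsto_nhdsWithin_iff.mpr ⟨h, hX.mono fun i hi => hi.nonneg⟩
  exact (CFC.continuousOn_sqrt (A := Matrix (Fin N) (Fin N) ℂ) Y hY.nonneg).tendsto.comp h1

/-- A self-adjoint element is at most its norm, so `1 - X ≤ ‖1 - X‖ ≤ 1` once `X` is close to `1`.
-/
theorem eventually_posSemidef_of_tendsto_one {ι : Type*} {l : Filter ι}
    {X : ι → Matrix (Fin N) (Fin N) ℂ} (hX : ∀ i, (X i).IsHermitian)
    (h : Tendsto X l (𝓝 1)) : ∀ᶠ i in l, (X i).PosSemidef := by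
  have h1 : Tendsto (fun i => ‖1 - X i‖) l (𝓝 0) := by
    have := (tendsto_const_nhds (x := (1 : Matrix (Fin N) (Fin N) ℂ))).sub h
    rw [sub_self] at this
    exact tendsto_zero_iff_norm_tendsto_zero.mp this
  filter_upwards [h1.eventually (ge_mem_nhds zero_lt_one)] with i hi
  have hsa : IsSelfAdjoint (1 - X i) := (IsSelfAdjoint.one _).sub (hX i)
  have h2 := hsa.le_algebraMap_norm_self
  have h3 : algebraMap ℝ (Matrix (Fin N) (Fin N) ℂ) ‖1 - X i‖ ≤ algebraMap ℝ _ 1 :=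
    algebraMap_mono _ hi
  rw [map_one] at h3
  have h4 := h2.trans h3
  exact Matrix.nonneg_iff_posSemidef.mp (by simpa using h4)

end L2Operator

theorem tendsto_matrix_inv {ι : Type*} {l : Filter ι} {X : ι → Matrix (Fin N) (Fin N) ℂ}
    {Y : Matrix (Fin N) (Fin N) ℂ} (h : Tendsto X l (𝓝 Y)) (hY : Y.det ≠ 0) :
    Tendsto (fun i => (X i)⁻¹) l (𝓝 Y⁻¹) := by
  have hdet : Tendsto (fun i => (X i).det) l (𝓝 Y.det) :=
    (continuous_id.matrix_det.tendsto Y).comp h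
  have hadj : Tendsto (fun i => (X i).adjugate) l (𝓝 Y.adjugate) :=
    (continuous_id.matrix_adjugate.tendsto Y).comp h
  simp only [Matrix.inv_def, Ring.inverse_eq_inv']
  exact (hdet.inv₀ hY).smul hadj

/-- The default value of `CFC.sqrt` is also nonnegative, so `G` need not be positive. The polar
decomposition below therefore holds for every `M`, not only for large `M`. -/
theorem sqrt_isHermitian (G : Matrix (Fin N) (Fin N) ℂ) : (CFC.sqrt G).IsHermitian :=
  (Matrix.nonneg_iff_posSemidef.mp (CFC.sqrt_nonneg G)).isHermitian

theorem det_sqrt_ne_zero {G : Matrix (Fin N) (Fin N) ℂ} (hG : G.PosDef) :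
    (CFC.sqrt G).det ≠ 0 := by
  intro h
  have h1 := CFC.sqrt_mul_sqrt_self G hG.posSemidef.nonneg
  have h2 := congrArg Matrix.det h1
  rw [Matrix.det_mul, h, mul_zero] at h2
  exact hG.det_pos.ne h2

/-- Conjugation by `Y^{-1/2}` moves the limit to `1`; the determinant, nonzero in the limit,
upgrades semidefinite to definite. -/
theorem eventually_posDef {ι : Type*} {l : Filter ι} {X : ι → Matrix (Fin N) (Fin N) ℂ}
    {Y : Matrix (Fin N) (Fin N) ℂ} (hX : ∀ i, (X i).IsHermitian) (hY : Y.PosDef)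
    (h : Tendsto X l (𝓝 Y)) : ∀ᶠ i in l, (X i).PosDef := by
  set R := CFC.sqrt Y with hR
  have hRH : R.IsHermitian := sqrt_isHermitian Y
  have hRdet : IsUnit R.det := (det_sqrt_ne_zero hY).isUnit
  have hRR : R * R = Y := CFC.sqrt_mul_sqrt_self Y hY.posSemidef.nonneg
  have h1 : Tendsto (fun i => R⁻¹ * X i * R⁻¹) l (𝓝 1) := by
    have h2 : R⁻¹ * Y * R⁻¹ = 1 := by
      rw [← hRR, ← mul_assoc, Matrix.nonsing_inv_mul R hRdet, one_mul,
        Matrix.mul_nonsing_inv R hRdet]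
    rw [← h2]
    exact (tendsto_const_nhds.mul h).mul tendsto_const_nhds
  have h3 := eventually_posSemidef_of_tendsto_one (fun i => by
    have := Matrix.isHermitian_conjTranspose_mul_mul (R⁻¹) (hX i)
    rwa [Matrix.conjTranspose_nonsing_inv, hRH.eq] at this) h1
  have hdet : Tendsto (fun i => (X i).det) l (𝓝 Y.det) :=
    (continuous_id.matrix_det.tendsto Y).comp h
  filter_upwards [h3, hdet.eventually_ne hY.det_pos.ne'] with i hi hdi
  have h4 := hi.conjTranspose_mul_mul_same R
  have h5 : Rᴴ * (R⁻¹ * X i * R⁻¹) * R = X i := by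
    rw [hRH.eq, ← mul_assoc, ← mul_assoc, Matrix.mul_nonsing_inv R hRdet, one_mul, mul_assoc,
      Matrix.nonsing_inv_mul R hRdet, mul_one]
  rw [h5] at h4
  exact h4.posDef_iff_det_ne_zero.mpr hdi

theorem star_dotProduct_self (v : Fin N → ℂ) :
    star v ⬝ᵥ v = ((∑ i, ‖v i‖ ^ 2 : ℝ) : ℂ) := by
  simp only [dotProduct, Pi.star_apply, RCLike.star_def, Complex.conj_mul']
  push_cast
  rfl

/-- `Fin N → ℂ` carries the sup norm, while unitary matrices preserve the Euclidean one. This lemma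
and the next pass between the two. -/
theorem tendsto_zero_of_sum_norm_sq {ι : Type*} {l : Filter ι} {v : ι → Fin N → ℂ}
    (h : Tendsto (fun i => ∑ j, ‖v i j‖ ^ 2) l (𝓝 0)) : Tendsto v l (𝓝 0) := by
  rw [tendsto_pi_nhds]
  intro j
  have h1 : Tendsto (fun i => ‖v i j‖ ^ 2) l (𝓝 0) :=
    squeeze_zero (fun i => by positivity)
      (fun i => Finset.single_le_sum (f := fun j => ‖v i j‖ ^ 2) (fun _ _ => by positivity)
        (Finset.mem_univ j)) h
  have h2 := h1.sqrt
  simp only [Real.sqrt_sq (norm_nonneg _), Real.sqrt_zero] at h2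
  exact tendsto_zero_iff_norm_tendsto_zero.mpr h2

theorem sum_norm_sq_tendsto_zero {ι : Type*} {l : Filter ι} {v : ι → Fin N → ℂ}
    (h : Tendsto v l (𝓝 0)) : Tendsto (fun i => ∑ j, ‖v i j‖ ^ 2) l (𝓝 0) := by
  have h1 : Continuous fun v : Fin N → ℂ => ∑ j, ‖v j‖ ^ 2 := by fun_prop
  simpa [Function.comp_def] using (h1.tendsto 0).comp h

theorem star_mulVec_dotProduct_mulVec (B C : Matrix (Fin N) (Fin N) ℂ) (v w : Fin N → ℂ) :
    star (B *ᵥ v) ⬝ᵥ (C *ᵥ w) = star v ⬝ᵥ ((Bᴴ * C) *ᵥ w) := by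
  rw [Matrix.star_mulVec, ← Matrix.dotProduct_mulVec, Matrix.mulVec_mulVec]

theorem sum_norm_sq_mulVec_unitary {B : Matrix (Fin N) (Fin N) ℂ} (hB : Bᴴ * B = 1)
    (v : Fin N → ℂ) : ∑ i, ‖(B *ᵥ v) i‖ ^ 2 = ∑ i, ‖v i‖ ^ 2 := by
  rw [← Complex.ofReal_inj, ← star_dotProduct_self, ← star_dotProduct_self,
    star_mulVec_dotProduct_mulVec, hB, Matrix.one_mulVec]

theorem tendsto_unitary_mulVec_zero {ι : Type*} {l : Filter ι}
    {B : ι → Matrix (Fin N) (Fin N) ℂ} (hB : ∀ i, (B i)ᴴ * B i = 1) {v : ι → Fin N → ℂ}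
    (h : Tendsto v l (𝓝 0)) : Tendsto (fun i => B i *ᵥ v i) l (𝓝 0) := by
  refine tendsto_zero_of_sum_norm_sq ?_
  simp only [sum_norm_sq_mulVec_unitary (hB _)]
  exact sum_norm_sq_tendsto_zero h

/-- For `P ≥ 0`, `P x` is closer to `x` than `P² x`. -/
theorem sum_norm_sq_mulVec_sub_le {P : Matrix (Fin N) (Fin N) ℂ} (hP : P.PosSemidef)
    (x : Fin N → ℂ) :
    ∑ i, ‖(P *ᵥ x - x) i‖ ^ 2 ≤ ∑ i, ‖((P * P) *ᵥ x - x) i‖ ^ 2 := by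
  set y := P *ᵥ x - x with hy
  -- `P² - 1 = (P + 1)(P - 1)`, and `P + 1` does not shorten vectors when `P ≥ 0`.
  have h1 : (P * P) *ᵥ x - x = P *ᵥ y + y := by
    rw [hy, Matrix.mulVec_sub, Matrix.mulVec_mulVec]; abel
  have h2 : 0 ≤ (star y ⬝ᵥ (P *ᵥ y)).re := hP.re_dotProduct_nonneg y
  have h3 : star (P *ᵥ y) ⬝ᵥ y = star y ⬝ᵥ (P *ᵥ y) := by
    have := star_mulVec_dotProduct_mulVec P 1 y y
    rwa [Matrix.one_mulVec, mul_one, hP.isHermitian.eq] at this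
  have h4 : star (P *ᵥ y + y) ⬝ᵥ (P *ᵥ y + y)
      = star (P *ᵥ y) ⬝ᵥ (P *ᵥ y) + 2 * (star y ⬝ᵥ (P *ᵥ y)) + star y ⬝ᵥ y := by
    rw [star_add, add_dotProduct, dotProduct_add, dotProduct_add, h3]; ring
  have h5 := congrArg Complex.re h4
  rw [star_dotProduct_self, star_dotProduct_self, star_dotProduct_self] at h5
  simp only [Complex.add_re, Complex.ofReal_re, Complex.mul_re, Complex.re_ofNat, Complex.im_ofNat,
    zero_mul, sub_zero] at h5
  rw [h1, h5]
  have h6 : 0 ≤ ∑ i, ‖(P *ᵥ y) i‖ ^ 2 := by positivity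
  linarith

/-- The unitary parts of a convergent sequence of matrices follow every orbit on which the limit is
isometric. -/
theorem tendsto_unitary_pow_mulVec {S B P : ℕ → Matrix (Fin N) (Fin N) ℂ}
    {T : Matrix (Fin N) (Fin N) ℂ} (hB : ∀ M, (B M)ᴴ * B M = 1) (hP : ∀ M, (P M).PosSemidef)
    (hS : ∀ M, S M = B M * P M) (hST : Tendsto S atTop (𝓝 T)) {L : ℕ} {x : ℕ → Fin N → ℂ}
    (hx : ∀ l < L, T *ᵥ x l = x (l + 1)) (hx' : ∀ l < L, Tᴴ *ᵥ x (l + 1) = x l)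
    {y : ℕ → Fin N → ℂ} (hy : Tendsto y atTop (𝓝 (x 0))) {l : ℕ} (hl : l ≤ L) :
    Tendsto (fun M => (B M) ^ l *ᵥ y M) atTop (𝓝 (x l)) := by
  have hmul : ∀ {X : ℕ → Matrix (Fin N) (Fin N) ℂ} {Y : Matrix (Fin N) (Fin N) ℂ} (v : Fin N → ℂ),
      Tendsto X atTop (𝓝 Y) → Tendsto (fun M => X M *ᵥ v) atTop (𝓝 (Y *ᵥ v)) := by
    intro X Y v h
    have hc : Continuous fun Z : Matrix (Fin N) (Fin N) ℂ => Z *ᵥ v :=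
      continuous_id.matrix_mulVec continuous_const
    exact (hc.tendsto Y).comp h
  induction l with
  | zero => simpa using hy
  | succ l ih =>
    have hlL : l < L := hl
    have hPP : ∀ M, P M * P M = (S M)ᴴ * S M := by
      intro M
      rw [hS, Matrix.conjTranspose_mul, (hP M).isHermitian.eq, mul_assoc, ← mul_assoc (B M)ᴴ, hB,
        one_mul]
    -- `P² = S^*S` converges to `T^*T`, which fixes `x l`.
    have h1 : Tendsto (fun M => (P M * P M) *ᵥ x l - x l) atTop (𝓝 0) := by
      have h2 : Tendsto (fun M => (S M)ᴴ * S M) atTop (𝓝 (Tᴴ * T)) :=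
        ((continuous_id.matrix_conjTranspose.tendsto T).comp hST).mul hST
      have h3 := (hmul (x l) h2).sub_const (x l)
      rw [← Matrix.mulVec_mulVec, hx l hlL, hx' l hlL, sub_self] at h3
      simpa only [hPP] using h3
    have h2 : Tendsto (fun M => P M *ᵥ x l - x l) atTop (𝓝 0) :=
      tendsto_zero_of_sum_norm_sq (squeeze_zero (fun M => by positivity)
        (fun M => sum_norm_sq_mulVec_sub_le (hP M) (x l)) (sum_norm_sq_tendsto_zero h1))
    have h3 := tendsto_unitary_mulVec_zero hB h2
    have h4 : Tendsto (fun M => (B M) ^ l *ᵥ y M - x l) atTop (𝓝 0) := by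
      have := (ih hlL.le).sub_const (x l)
      rwa [sub_self] at this
    have h5 := tendsto_unitary_mulVec_zero hB h4
    -- `B^(l+1) y = S x_l - B (P x_l - x_l) + B (B^l y - x_l)`. The last two terms vanish in the
    -- limit because `B` is isometric, whether or not it converges.
    have h6 := ((hmul (x l) hST).sub h3).add h5
    rw [sub_zero, add_zero, hx l hlL] at h6
    refine h6.congr fun M => ?_
    rw [Matrix.mulVec_sub, Matrix.mulVec_sub, Matrix.mulVec_mulVec, Matrix.mulVec_mulVec, ← hS,
      pow_succ']
    abel

/-- The unitary parts of a sequence of matrices with invertible limit converge. -/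
theorem exists_tendsto_unitary {S B P : ℕ → Matrix (Fin N) (Fin N) ℂ}
    {T : Matrix (Fin N) (Fin N) ℂ} (hB : ∀ M, (B M)ᴴ * B M = 1) (hP : ∀ M, (P M).PosSemidef)
    (hS : ∀ M, S M = B M * P M) (hST : Tendsto S atTop (𝓝 T)) (hT : T.det ≠ 0) :
    ∃ C, Tendsto B atTop (𝓝 C) := by
  have hPP : ∀ M, P M * P M = (S M)ᴴ * S M := by
    intro M
    rw [hS, Matrix.conjTranspose_mul, (hP M).isHermitian.eq, mul_assoc, ← mul_assoc (B M)ᴴ, hB,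
      one_mul]
  -- By uniqueness of the positive square root `P` is a continuous function of `S`; its limit is
  -- invertible, so eventually `B = S P⁻¹`.
  have hPs : ∀ M, CFC.sqrt ((S M)ᴴ * S M) = P M := fun M =>
    CFC.sqrt_unique (hPP M) (hP M).nonneg
  have h2 : Tendsto (fun M => (S M)ᴴ * S M) atTop (𝓝 (Tᴴ * T)) :=
    ((continuous_id.matrix_conjTranspose.tendsto T).comp hST).mul hST
  have hTT := Matrix.posSemidef_conjTranspose_mul_self T
  have h3 := tendsto_sqrt_of_posSemidef
    (Eventually.of_forall fun M => Matrix.posSemidef_conjTranspose_mul_self (S M)) hTT h2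
  simp only [hPs] at h3
  have hpd : (Tᴴ * T).PosDef := hTT.posDef_iff_det_ne_zero.mpr (by
    rw [Matrix.det_mul, Matrix.det_conjTranspose]
    exact mul_ne_zero (star_ne_zero.mpr hT) hT)
  have hdet := det_sqrt_ne_zero hpd
  have h4 := hST.mul (tendsto_matrix_inv h3 hdet)
  refine ⟨_, h4.congr' ?_⟩
  have h5 : Tendsto (fun M => (P M).det) atTop (𝓝 (CFC.sqrt (Tᴴ * T)).det) :=
    (continuous_id.matrix_det.tendsto _).comp h3
  filter_upwards [h5.eventually_ne hdet] with M hM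
  rw [hS, mul_assoc, Matrix.mul_nonsing_inv _ hM.isUnit, mul_one]

end Matrices

/-! ### The output of the algorithm as a polar decomposition and its spectral measure. -/

section Algorithm

open Matrix
open scoped ComplexOrder

variable {N : ℕ} {G A : Matrix (Fin N) (Fin N) ℂ}

/-- The unitary matrix `U₂ U₁^*` of a run of the algorithm. -/
def Output.unitaryPart (out : Output G A) : Matrix (Fin N) (Fin N) ℂ :=
  out.U₂.1 * out.U₁.1ᴴ

/-- The positive factor `U₁ Σ U₁^*` of a run of the algorithm. -/
def Output.positivePart (out : Output G A) : Matrix (Fin N) (Fin N) ℂ :=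
  out.U₁.1 * Matrix.diagonal (fun j => (out.sigma j : ℂ)) * out.U₁.1ᴴ

theorem conjTranspose_mul_self_unitaryGroup (V : Matrix.unitaryGroup (Fin N) ℂ) :
    V.1ᴴ * V.1 = 1 :=
  Matrix.mem_unitaryGroup_iff'.mp V.2

theorem Output.unitaryPart_conjTranspose_mul_self (out : Output G A) :
    out.unitaryPartᴴ * out.unitaryPart = 1 := by
  have h1 : out.U₁.1 * out.U₁.1ᴴ = 1 := Matrix.mem_unitaryGroup_iff.mp out.U₁.2
  rw [unitaryPart, Matrix.conjTranspose_mul, Matrix.conjTranspose_conjTranspose, mul_assoc,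
    ← mul_assoc (out.U₂.1)ᴴ, conjTranspose_mul_self_unitaryGroup, one_mul, h1]

theorem Output.positivePart_posSemidef (out : Output G A) : out.positivePart.PosSemidef := by
  have h : (Matrix.diagonal (fun j => (out.sigma j : ℂ))).PosSemidef :=
    Matrix.posSemidef_diagonal_iff.mpr fun j => by exact_mod_cast out.sigma_nonneg j
  exact h.mul_mul_conjTranspose_same _

/-- The adjoint of the singular value decomposition is `U₂ Σ U₁^* = (U₂ U₁^*)(U₁ Σ U₁^*)`. -/
theorem Output.polar (out : Output G A) :
    (CFC.sqrt G)⁻¹ * A * (CFC.sqrt G)⁻¹ = out.unitaryPart * out.positivePart := by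
  have hR : ((CFC.sqrt G)⁻¹)ᴴ = (CFC.sqrt G)⁻¹ := by
    rw [Matrix.conjTranspose_nonsing_inv, (sqrt_isHermitian G).eq]
  have h := congrArg Matrix.conjTranspose out.svd
  simp only [Matrix.conjTranspose_mul, Matrix.conjTranspose_conjTranspose, hR,
    Matrix.diagonal_conjTranspose] at h
  have hd : (star fun j => (out.sigma j : ℂ)) = fun j => (out.sigma j : ℂ) := by
    ext j; simp
  rw [hd] at h
  rw [mul_assoc, h, unitaryPart, positivePart]
  simp only [mul_assoc]
  rw [← mul_assoc (out.U₁.1)ᴴ, conjTranspose_mul_self_unitaryGroup, one_mul]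

theorem Output.unitaryPart_pow (out : Output G A) (l : ℕ) :
    out.unitaryPart ^ l
      = out.Vhat.1 * Matrix.diagonal (fun j => (out.eigenvalue j : ℂ) ^ l) * out.Vhat.1ᴴ := by
  have h1 : out.Vhat.1 * out.Vhat.1ᴴ = 1 := Matrix.mem_unitaryGroup_iff.mp out.Vhat.2
  induction l with
  | zero => simp [h1]
  | succ l ih =>
    rw [pow_succ, ih]
    have h2 : out.unitaryPart = _ := out.eigen
    rw [h2]
    calc _ = out.Vhat.1 * Matrix.diagonal (fun j => (out.eigenvalue j : ℂ) ^ l)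
          * (out.Vhat.1ᴴ * out.Vhat.1) * Matrix.diagonal (fun j => (out.eigenvalue j : ℂ))
          * out.Vhat.1ᴴ := by simp only [mul_assoc]
      _ = _ := by
        rw [conjTranspose_mul_self_unitaryGroup, mul_one, mul_assoc out.Vhat.1,
          Matrix.diagonal_mul_diagonal]
        simp only [pow_succ]

/-- Since `G^{-1/2} G = G^{1/2}`, the weights of the computed measure are the squared moduli of the
coordinates of `√G c` in the orthonormal eigenbasis `V̂`. Thus it is the spectral measure of `U₂
U₁^*` at the vector `√G c`. -/
theorem Output.eigenvector_dotProduct (out : Output G A) (hG : G.PosDef) (c : Fin N → ℂ)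
    (j : Fin N) :
    star (out.eigenvector j) ⬝ᵥ (G *ᵥ c) = (out.Vhat.1ᴴ *ᵥ (CFC.sqrt G *ᵥ c)) j := by
  set R := CFC.sqrt G with hRdef
  have hRR : R * R = G := CFC.sqrt_mul_sqrt_self G hG.posSemidef.nonneg
  have hRdet : IsUnit R.det := (det_sqrt_ne_zero hG).isUnit
  have hR : (R⁻¹)ᴴ = R⁻¹ := by
    rw [Matrix.conjTranspose_nonsing_inv, (sqrt_isHermitian G).eq]
  have h1 : star (out.eigenvector j) ⬝ᵥ (G *ᵥ c) = ((R⁻¹ * out.Vhat.1)ᴴ *ᵥ (G *ᵥ c)) j := rfl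
  have h2 : R⁻¹ * G = R := by
    calc R⁻¹ * G = R⁻¹ * (R * R) := by rw [hRR]
      _ = R := by rw [← mul_assoc, Matrix.nonsing_inv_mul R hRdet, one_mul]
  rw [h1, Matrix.conjTranspose_mul, hR, Matrix.mulVec_mulVec, Matrix.mulVec_mulVec,
    mul_assoc, h2]

theorem Output.integral_spectralMeasure (out : Output G A) (c : Fin N → ℂ) (φ : Circle → ℂ) :
    ∫ z, φ z ∂(out.spectralMeasure c)
      = ∑ j, ((‖star (out.eigenvector j) ⬝ᵥ (G *ᵥ c)‖ ^ 2 : ℝ) : ℂ) * φ (out.eigenvalue j) := by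
  rw [spectralMeasure, integral_finsetSum_measure]
  · refine Finset.sum_congr rfl fun j _ => ?_
    rw [integral_smul_measure, integral_dirac, ENNReal.toReal_ofReal (by positivity),
      Complex.real_smul]
  · exact fun j _ => (integrable_dirac (by simp)).smul_measure ENNReal.ofReal_ne_top

theorem Output.integral_pow_spectralMeasure (out : Output G A) (hG : G.PosDef) (c : Fin N → ℂ)
    (l : ℕ) :
    ∫ z : Circle, (z : ℂ) ^ l ∂(out.spectralMeasure c)
      = star (CFC.sqrt G *ᵥ c) ⬝ᵥ (out.unitaryPart ^ l *ᵥ (CFC.sqrt G *ᵥ c)) := by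
  rw [out.integral_spectralMeasure, out.unitaryPart_pow, ← Matrix.mulVec_mulVec,
    ← Matrix.mulVec_mulVec, Matrix.dotProduct_mulVec, ← Matrix.conjTranspose_conjTranspose
      out.Vhat.1, ← Matrix.star_mulVec, Matrix.conjTranspose_conjTranspose]
  simp only [out.eigenvector_dotProduct hG]
  refine Finset.sum_congr rfl fun j _ => ?_
  rw [Matrix.mulVec_diagonal, Pi.star_apply, RCLike.star_def]
  push_cast
  rw [← Complex.conj_mul']
  ring

theorem Output.isProbabilityMeasure_spectralMeasure (out : Output G A) (hG : G.PosDef)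
    {c : Fin N → ℂ} (hc : star c ⬝ᵥ (G *ᵥ c) = 1) :
    IsProbabilityMeasure (out.spectralMeasure c) := by
  constructor
  have h1 : out.spectralMeasure c Set.univ
      = ∑ j, ENNReal.ofReal (‖star (out.eigenvector j) ⬝ᵥ (G *ᵥ c)‖ ^ 2) := by
    simp [spectralMeasure]
  rw [h1, ← ENNReal.ofReal_sum_of_nonneg (fun _ _ => by positivity), ← ENNReal.ofReal_one]
  congr 1
  simp only [out.eigenvector_dotProduct hG]
  have h2 : (out.Vhat.1ᴴ)ᴴ * out.Vhat.1ᴴ = 1 := by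
    rw [Matrix.conjTranspose_conjTranspose]
    exact Matrix.mem_unitaryGroup_iff.mp out.Vhat.2
  rw [sum_norm_sq_mulVec_unitary h2, ← Complex.ofReal_inj, ← star_dotProduct_self,
    star_mulVec_dotProduct_mulVec, (sqrt_isHermitian G).eq,
    CFC.sqrt_mul_sqrt_self G hG.posSemidef.nonneg, hc, Complex.ofReal_one]

theorem normalizedCoeff_dotProduct (hG : G.PosDef) {c : Fin N → ℂ} (hc : c ≠ 0) :
    star (normalizedCoeff G c) ⬝ᵥ (G *ᵥ normalizedCoeff G c) = 1 := by
  have hpos := hG.dotProduct_mulVec_pos hc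
  obtain ⟨hre, him⟩ := Complex.pos_iff.mp hpos
  set r := (star c ⬝ᵥ (G *ᵥ c)).re with hr
  have h1 : star c ⬝ᵥ (G *ᵥ c) = (r : ℂ) := Complex.ext rfl (by simpa using him.symm)
  have h2 : normalizedCoeff G c = (((Real.sqrt r)⁻¹ : ℝ) : ℂ) • c := by
    ext i
    simp [normalizedCoeff, hr]
  rw [h2, Matrix.mulVec_smul, star_smul, smul_dotProduct, dotProduct_smul, h1]
  simp only [smul_eq_mul, RCLike.star_def, Complex.conj_ofReal, ← Complex.ofReal_mul]
  rw [← Complex.ofReal_one, Complex.ofReal_inj]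
  have h3 := Real.mul_self_sqrt hre.le
  have h4 : Real.sqrt r ≠ 0 := (Real.sqrt_pos.mpr hre).ne'
  field_simp
  nlinarith [h3]

end Algorithm

/-! ### Convergence of the computed moments under convergence of the quadrature. -/

section Convergence

open Matrix
open scoped ComplexOrder

theorem gramMatrix_isHermitian {Ω : Type u} {M N : ℕ} (ψ : Fin N → Ω → ℂ) (x : Fin M → Ω)
    (w : Fin M → ℝ) : (gramMatrix ψ x w).IsHermitian := by
  refine Matrix.isHermitian_conjTranspose_mul_mul _ ?_
  rw [weightMatrix, Matrix.isHermitian_diagonal_iff]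
  exact fun m => Complex.conj_ofReal _

variable {H : Type u} [NormedAddCommGroup H] [InnerProductSpace ℂ H] {N : ℕ}

/-- The matrix of the compression of `K` in the (non-orthogonal) coordinates `ψ`. -/
def compressionMatrix (K : H →ₗᵢ[ℂ] H) (ψ : Fin N → H) : Matrix (Fin N) (Fin N) ℂ :=
  Matrix.of fun j k => ⟪ψ j, K (ψ k)⟫_ℂ

theorem gram_mulVec (ψ : Fin N → H) (d : Fin N → ℂ) (j : Fin N) :
    (Matrix.gram ℂ ψ *ᵥ d) j = ⟪ψ j, ∑ k, d k • ψ k⟫_ℂ := by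
  simp only [Matrix.mulVec, dotProduct, Matrix.gram_apply, inner_sum, inner_smul_right]
  exact Finset.sum_congr rfl fun k _ => mul_comm _ _

theorem compressionMatrix_mulVec (K : H →ₗᵢ[ℂ] H) (ψ : Fin N → H) (d : Fin N → ℂ) (j : Fin N) :
    (compressionMatrix K ψ *ᵥ d) j = ⟪ψ j, K (∑ k, d k • ψ k)⟫_ℂ := by
  simp only [Matrix.mulVec, dotProduct, compressionMatrix, Matrix.of_apply, map_sum, map_smul,
    inner_sum, inner_smul_right]
  exact Finset.sum_congr rfl fun k _ => mul_comm _ _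

theorem compressionMatrix_conjTranspose_mulVec (K : H →ₗᵢ[ℂ] H) (ψ : Fin N → H)
    (d : Fin N → ℂ) (j : Fin N) :
    ((compressionMatrix K ψ)ᴴ *ᵥ d) j = ⟪K (ψ j), ∑ k, d k • ψ k⟫_ℂ := by
  simp only [Matrix.mulVec, dotProduct, compressionMatrix, Matrix.conjTranspose_apply,
    Matrix.of_apply, RCLike.star_def, inner_conj_symm, inner_sum, inner_smul_right]
  exact Finset.sum_congr rfl fun k _ => mul_comm _ _

variable {ψ : Fin N → H} {K : H →ₗᵢ[ℂ] H} {g : H} {c : Fin N → ℂ}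
  {G A : ℕ → Matrix (Fin N) (Fin N) ℂ}

theorem eventually_isProbabilityMeasure_spectralMeasure (hψ : LinearIndependent ℂ ψ)
    (hc : c ≠ 0) (hGH : ∀ M, (G M).IsHermitian) (hG : Tendsto G atTop (𝓝 (Matrix.gram ℂ ψ)))
    (out : ∀ M, Output (G M) (A M)) :
    ∀ᶠ M in atTop,
      IsProbabilityMeasure ((out M).spectralMeasure (normalizedCoeff (G M) c)) := by
  filter_upwards [eventually_posDef hGH (Matrix.posDef_gram_of_linearIndependent hψ) hG] with M hM
  exact (out M).isProbabilityMeasure_spectralMeasure hM (normalizedCoeff_dotProduct hM hc)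

theorem tendsto_sqrt_gram (hψ : LinearIndependent ℂ ψ) (hGH : ∀ M, (G M).IsHermitian)
    (hG : Tendsto G atTop (𝓝 (Matrix.gram ℂ ψ))) :
    Tendsto (fun M => CFC.sqrt (G M)) atTop (𝓝 (CFC.sqrt (Matrix.gram ℂ ψ))) := by
  have hpd := Matrix.posDef_gram_of_linearIndependent hψ
  exact tendsto_sqrt_of_posSemidef ((eventually_posDef hGH hpd hG).mono fun M h => h.posSemidef)
    hpd.posSemidef hG

theorem tendsto_polar (hψ : LinearIndependent ℂ ψ) (hGH : ∀ M, (G M).IsHermitian)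
    (hG : Tendsto G atTop (𝓝 (Matrix.gram ℂ ψ)))
    (hA : Tendsto A atTop (𝓝 (compressionMatrix K ψ))) :
    Tendsto (fun M => (CFC.sqrt (G M))⁻¹ * A M * (CFC.sqrt (G M))⁻¹) atTop
      (𝓝 ((CFC.sqrt (Matrix.gram ℂ ψ))⁻¹ * compressionMatrix K ψ
        * (CFC.sqrt (Matrix.gram ℂ ψ))⁻¹)) := by
  have h := tendsto_matrix_inv (tendsto_sqrt_gram hψ hGH hG)
    (det_sqrt_ne_zero (Matrix.posDef_gram_of_linearIndependent hψ))
  exact (h.mul hA).mul h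

theorem tendsto_normalizedCoeff (hg : ‖g‖ = 1) (hc : g = ∑ j, c j • ψ j)
    (hG : Tendsto G atTop (𝓝 (Matrix.gram ℂ ψ))) :
    Tendsto (fun M => normalizedCoeff (G M) c) atTop (𝓝 c) := by
  have h1 : star c ⬝ᵥ (Matrix.gram ℂ ψ *ᵥ c) = 1 := by
    rw [Matrix.star_dotProduct_gram_mulVec, ← hc, inner_self_eq_norm_sq_to_K, hg]
    simp
  have hcont : Continuous fun X : Matrix (Fin N) (Fin N) ℂ => (star c ⬝ᵥ (X *ᵥ c)).re :=
    Complex.continuous_re.comp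
      (continuous_const.dotProduct (continuous_id.matrix_mulVec continuous_const))
  have h2 := (hcont.tendsto _).comp hG
  rw [h1, Complex.one_re] at h2
  have h3 := (h2.sqrt.inv₀ (by simp)).smul_const c
  simpa [normalizedCoeff, Function.comp_def] using h3

theorem tendsto_mulVec {X : ℕ → Matrix (Fin N) (Fin N) ℂ} {Y : Matrix (Fin N) (Fin N) ℂ}
    {v : ℕ → Fin N → ℂ} {a : Fin N → ℂ} (hX : Tendsto X atTop (𝓝 Y))
    (hv : Tendsto v atTop (𝓝 a)) : Tendsto (fun M => X M *ᵥ v M) atTop (𝓝 (Y *ᵥ a)) := by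
  have hcont : Continuous fun p : Matrix (Fin N) (Fin N) ℂ × (Fin N → ℂ) => p.1 *ᵥ p.2 :=
    continuous_fst.matrix_mulVec continuous_snd
  have h : Tendsto (fun M => (X M, v M)) atTop (𝓝 (Y, a)) := hX.prodMk_nhds hv
  simpa only [Function.comp_def] using (hcont.tendsto (Y, a)).comp h

theorem tendsto_star_dotProduct {u v : ℕ → Fin N → ℂ} {a b : Fin N → ℂ}
    (hu : Tendsto u atTop (𝓝 a)) (hv : Tendsto v atTop (𝓝 b)) :
    Tendsto (fun M => star (u M) ⬝ᵥ v M) atTop (𝓝 (star a ⬝ᵥ b)) := by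
  have hcont : Continuous fun p : (Fin N → ℂ) × (Fin N → ℂ) => star p.1 ⬝ᵥ p.2 :=
    continuous_fst.star.dotProduct continuous_snd
  have h : Tendsto (fun M => (u M, v M)) atTop (𝓝 (a, b)) := hu.prodMk_nhds hv
  simpa only [Function.comp_def] using (hcont.tendsto (a, b)).comp h

theorem tendsto_sqrt_mulVec_normalizedCoeff (hψ : LinearIndependent ℂ ψ) (hg : ‖g‖ = 1)
    (hc : g = ∑ j, c j • ψ j) (hGH : ∀ M, (G M).IsHermitian)
    (hG : Tendsto G atTop (𝓝 (Matrix.gram ℂ ψ))) :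
    Tendsto (fun M => CFC.sqrt (G M) *ᵥ normalizedCoeff (G M) c) atTop
      (𝓝 (CFC.sqrt (Matrix.gram ℂ ψ) *ᵥ c)) := by
  exact tendsto_mulVec (tendsto_sqrt_gram hψ hGH hG) (tendsto_normalizedCoeff hg hc hG)

/-- The moments of the measures of the algorithm that the dictionary resolves converge to the
moments of the spectral measure. -/
theorem tendsto_integral_pow_spectralMeasure (hψ : LinearIndependent ℂ ψ) (hg : ‖g‖ = 1)
    (hc : g = ∑ j, c j • ψ j) {L : ℕ}
    (hL : ∀ l ≤ L, K^[l] g ∈ Submodule.span ℂ (Set.range ψ))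
    (hGH : ∀ M, (G M).IsHermitian) (hG : Tendsto G atTop (𝓝 (Matrix.gram ℂ ψ)))
    (hA : Tendsto A atTop (𝓝 (compressionMatrix K ψ))) (out : ∀ M, Output (G M) (A M))
    {l : ℕ} (hl : l ≤ L) :
    Tendsto (fun M => ∫ z : Circle, (z : ℂ) ^ l
      ∂((out M).spectralMeasure (normalizedCoeff (G M) c))) atTop (𝓝 ⟪g, K^[l] g⟫_ℂ) := by
  have hpd := Matrix.posDef_gram_of_linearIndependent hψ
  -- `d l` are the coordinates of `K^l g` in the dictionary, with default `0` beyond `L`. The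
  -- vectors `√Γ d l`, with `Γ` the Gram matrix, are the orbit to be followed.
  have hd : ∀ l, ∃ d : Fin N → ℂ, l ≤ L → ∑ j, d j • ψ j = K^[l] g := by
    intro l
    by_cases h : l ≤ L
    · obtain ⟨d, hd⟩ := (Submodule.mem_span_range_iff_exists_fun ℂ).mp (hL l h)
      exact ⟨d, fun _ => hd⟩
    · exact ⟨0, fun h' => absurd h' h⟩
  choose d hd using hd
  have hd0 : d 0 = c := by
    have h1 := hd 0 (Nat.zero_le _)
    rw [Function.iterate_zero, id, hc] at h1
    exact hψ.fintypeLinearCombination_injective (by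
      simpa [Fintype.linearCombination_apply] using h1)
  set R := CFC.sqrt (Matrix.gram ℂ ψ) with hRdef
  have hRH : Rᴴ = R := (sqrt_isHermitian _).eq
  have hRR : R * R = Matrix.gram ℂ ψ := CFC.sqrt_mul_sqrt_self _ hpd.posSemidef.nonneg
  have hRdet : IsUnit R.det := (det_sqrt_ne_zero hpd).isUnit
  have hRΓ : R⁻¹ * Matrix.gram ℂ ψ = R := by
    rw [← hRR, ← mul_assoc, Matrix.nonsing_inv_mul R hRdet, one_mul]
  have hstep : ∀ l < L, compressionMatrix K ψ *ᵥ d l = Matrix.gram ℂ ψ *ᵥ d (l + 1) := by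
    intro l hl
    ext j
    rw [compressionMatrix_mulVec, gram_mulVec, hd l hl.le, hd (l + 1) hl,
      Function.iterate_succ_apply']
  -- Here the isometry of `K` enters: `⟪K ψ_j, K^(l+1) g⟫ = ⟪ψ_j, K^l g⟫`.
  have hstep' : ∀ l < L, (compressionMatrix K ψ)ᴴ *ᵥ d (l + 1) = Matrix.gram ℂ ψ *ᵥ d l := by
    intro l hl
    ext j
    rw [compressionMatrix_conjTranspose_mulVec, gram_mulVec, hd l hl.le, hd (l + 1) hl,
      Function.iterate_succ_apply', K.inner_map_map]
  have hmain := tendsto_unitary_pow_mulVec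
    (fun M => (out M).unitaryPart_conjTranspose_mul_self)
    (fun M => (out M).positivePart_posSemidef) (fun M => (out M).polar)
    (tendsto_polar hψ hGH hG hA) (L := L) (x := fun l => R *ᵥ d l)
    (fun l hl => by
      rw [← hRdef, Matrix.mulVec_mulVec, mul_assoc, Matrix.nonsing_inv_mul R hRdet, mul_one,
        ← Matrix.mulVec_mulVec, hstep l hl, Matrix.mulVec_mulVec, hRΓ])
    (fun l hl => by
      rw [← hRdef, Matrix.conjTranspose_mul, Matrix.conjTranspose_mul,
        Matrix.conjTranspose_nonsing_inv, hRH, Matrix.mulVec_mulVec, mul_assoc, mul_assoc,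
        Matrix.nonsing_inv_mul R hRdet, mul_one,
        ← Matrix.mulVec_mulVec, hstep' l hl, Matrix.mulVec_mulVec, hRΓ])
    (y := fun M => CFC.sqrt (G M) *ᵥ normalizedCoeff (G M) c)
    (by
      rw [hd0]
      exact tendsto_sqrt_mulVec_normalizedCoeff hψ hg hc hGH hG) hl
  have hlim := tendsto_star_dotProduct
    (tendsto_sqrt_mulVec_normalizedCoeff hψ hg hc hGH hG) hmain
  have hval : star (R *ᵥ c) ⬝ᵥ (R *ᵥ d l) = ⟪g, K^[l] g⟫_ℂ := by
    rw [star_mulVec_dotProduct_mulVec, hRH, hRR, Matrix.star_dotProduct_gram_mulVec, ← hc, hd l hl]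
  rw [← hRdef, hval] at hlim
  refine hlim.congr' ?_
  filter_upwards [eventually_posDef hGH hpd hG] with M hM
  exact ((out M).integral_pow_spectralMeasure hM _ l).symm

/-- If the compression of `K` is invertible, all moments of the measures of the algorithm
converge. -/
theorem exists_tendsto_integral_pow_spectralMeasure (hψ : LinearIndependent ℂ ψ) (hg : ‖g‖ = 1)
    (hc : g = ∑ j, c j • ψ j)
    (hGH : ∀ M, (G M).IsHermitian) (hG : Tendsto G atTop (𝓝 (Matrix.gram ℂ ψ)))
    (hA : Tendsto A atTop (𝓝 (compressionMatrix K ψ))) (hdet : (compressionMatrix K ψ).det ≠ 0)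
    (out : ∀ M, Output (G M) (A M)) (l : ℕ) :
    ∃ a, Tendsto (fun M => ∫ z : Circle, (z : ℂ) ^ l
      ∂((out M).spectralMeasure (normalizedCoeff (G M) c))) atTop (𝓝 a) := by
  have hpd := Matrix.posDef_gram_of_linearIndependent hψ
  have hRdet := det_sqrt_ne_zero hpd
  obtain ⟨C, hC⟩ := exists_tendsto_unitary
    (fun M => (out M).unitaryPart_conjTranspose_mul_self)
    (fun M => (out M).positivePart_posSemidef) (fun M => (out M).polar)
    (tendsto_polar hψ hGH hG hA) (by
      rw [Matrix.det_mul, Matrix.det_mul, Matrix.det_nonsing_inv, Ring.inverse_eq_inv']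
      exact mul_ne_zero (mul_ne_zero (inv_ne_zero hRdet) hdet) (inv_ne_zero hRdet))
  have hy := tendsto_sqrt_mulVec_normalizedCoeff hψ hg hc hGH hG
  have hlim := tendsto_star_dotProduct hy (tendsto_mulVec (hC.pow l) hy)
  refine ⟨_, hlim.congr' ?_⟩
  filter_upwards [eventually_posDef hGH hpd hG] with M hM
  exact ((out M).integral_pow_spectralMeasure hM _ l).symm

end Convergence

/-! ### The rate in `L`, and the conclusion. -/

section Limsup

/-- Measures whose first `L` moments converge to those of `μ` are eventually within
`O(log L / L)` of `μ`. -/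
theorem limsup_wassersteinOne_le {μ : Measure Circle} [IsProbabilityMeasure μ]
    {ν : ℕ → Measure Circle} (hν : ∀ᶠ M in atTop, IsProbabilityMeasure (ν M)) {L : ℕ}
    (hL : 2 ≤ L)
    (hmom : ∀ l ≤ L, Tendsto (fun M => ∫ z : Circle, (z : ℂ) ^ l ∂(ν M)) atTop
      (𝓝 (∫ z : Circle, (z : ℂ) ^ l ∂μ))) :
    limsup (fun M => wassersteinOne μ (ν M)) atTop
      ≤ ENNReal.ofReal (32 * (Real.log L / L)) := by
  have hL0 : (0 : ℝ) < L := by exact_mod_cast (by omega : 0 < L)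
  -- The largest `m` with `2m - 1 ≤ L + 1`, so that only moments of order at most `L` are used.
  set m := L / 2 + 1 with hm
  have hm0 : (0 : ℝ) < m := by exact_mod_cast (by omega : 0 < m)
  have hLm : (L : ℝ) ≤ 2 * m := by exact_mod_cast (by omega : L ≤ 2 * m)
  -- The bound reached is `19/L`; as `L ≥ 2`, `19 ≤ 32 log 2 ≤ 32 log L`.
  have hlog : (0.6931471803 : ℝ) < Real.log L :=
    Real.log_two_gt_d9.trans_le (Real.log_le_log (by norm_num) (by exact_mod_cast hL))
  set δ : ℝ := 1 / (4 * m * L) with hδ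
  have hδ0 : 0 < δ := by positivity
  refine limsup_le_of_le (by isBoundedDefault) ?_
  have hev : ∀ l ∈ Finset.range (L + 1), ∀ᶠ M in atTop,
      ‖∫ z : Circle, (z : ℂ) ^ l ∂μ - ∫ z : Circle, (z : ℂ) ^ l ∂(ν M)‖ ≤ δ := by
    intro l hl
    filter_upwards [Metric.tendsto_nhds.mp (hmom l (by simpa [Nat.lt_succ_iff] using hl)) δ hδ0]
      with M hM
    rw [dist_comm, Complex.dist_eq] at hM
    exact hM.le
  filter_upwards [(Finset.eventually_all _).mpr hev, hν] with M hM _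
  refine (wassersteinOne_le_of_moments (m := m) (by omega)
    fun l hl => hM l (Finset.mem_range.mpr (by omega))).trans (ENNReal.ofReal_le_ofReal ?_)
  have h1 : 9 / (m : ℝ) ≤ 18 / L := by
    rw [div_le_div_iff₀ hm0 hL0]; linarith
  have h2 : 4 * m * δ = 1 / L := by
    rw [hδ]; field_simp
  calc 9 / (m : ℝ) + 4 * m * δ ≤ 18 / L + 1 / L := by rw [h2]; linarith
    _ = 19 / L := by ring
    _ ≤ 32 * Real.log L / L := by gcongr; linarith
    _ = 32 * (Real.log L / L) := by ring

end Limsup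

end MpEDMD

end

theorem corollary5p6 :
    ∃ C : ℝ, 0 < C ∧
      ∀ (Ω : Type*) [MeasurableSpace Ω] (ω : Measure Ω) (F : Ω → Ω)
        (hF : MeasurePreserving F ω ω)
        -- the dictionary
        (N : ℕ) (ψ : Fin N → Ω → ℂ) (hψ : ∀ j, MemLp (ψ j) 2 ω)
        (_ : LinearIndependent ℂ fun j => (hψ j).toLp (ψ j))
        -- the observable `g = Ψ c`
        (g : Lp ℂ 2 ω) (_ : ‖g‖ = 1) (c : Fin N → ℂ) (_ : g = ∑ j, c j • (hψ j).toLp (ψ j))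
        (L : ℕ) (_ : 2 ≤ L)
        (_ : ∀ l ≤ L, (MpEDMD.koopman F hF)^[l] g ∈
          Submodule.span ℂ (Set.range fun j => (hψ j).toLp (ψ j)))
        -- for every `M`, the `M` quadrature nodes and weights
        (x : ∀ M : ℕ, Fin M → Ω) (w : ∀ M : ℕ, Fin M → ℝ)
        (_ : ∀ j k, Tendsto (fun M => MpEDMD.gramMatrix ψ (x M) (w M) j k) atTop
          (𝓝 ⟪(hψ j).toLp (ψ j), (hψ k).toLp (ψ k)⟫_ℂ))
        (_ : ∀ j k, Tendsto (fun M => MpEDMD.crossMatrix F ψ (x M) (w M) j k) atTop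
          (𝓝 ⟪(hψ j).toLp (ψ j), MpEDMD.koopman F hF ((hψ k).toLp (ψ k))⟫_ℂ))
        -- for every `M`, a run of the algorithm on the data
        (out : ∀ M : ℕ, MpEDMD.Output (MpEDMD.gramMatrix ψ (x M) (w M))
          (MpEDMD.crossMatrix F ψ (x M) (w M))),
        limsup (fun M => MpEDMD.wassersteinOne
            (MpEDMD.scalarSpectralMeasure (MpEDMD.koopman F hF) g)
            ((out M).spectralMeasure
              (MpEDMD.normalizedCoeff (MpEDMD.gramMatrix ψ (x M) (w M)) c))) atTop
          ≤ ENNReal.ofReal (C * (Real.log L / L)) ∧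
        -- if the compression of the Koopman operator to `V_N` is invertible, the limit exists
        ((Matrix.of fun j k =>
            ⟪(hψ j).toLp (ψ j), MpEDMD.koopman F hF ((hψ k).toLp (ψ k))⟫_ℂ).det ≠ 0 →
          ∃ W : ℝ≥0∞, W ≤ ENNReal.ofReal (C * (Real.log L / L)) ∧
            Tendsto (fun M => MpEDMD.wassersteinOne
              (MpEDMD.scalarSpectralMeasure (MpEDMD.koopman F hF) g)
              ((out M).spectralMeasure
                (MpEDMD.normalizedCoeff (MpEDMD.gramMatrix ψ (x M) (w M)) c))) atTop (𝓝 W)) := by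
  refine ⟨32, by norm_num, ?_⟩
  intro Ω _ ω F hF N ψ hψ hli g hg c hc L hL hspan x w hG hA out
  set K := MpEDMD.koopman F hF with hK
  have hGH := fun M => MpEDMD.gramMatrix_isHermitian ψ (x M) (w M)
  have hG' : Tendsto (fun M => MpEDMD.gramMatrix ψ (x M) (w M)) atTop
      (𝓝 (Matrix.gram ℂ fun j => (hψ j).toLp (ψ j))) :=
    tendsto_pi_nhds.mpr fun j => tendsto_pi_nhds.mpr fun k => hG j k
  have hA' : Tendsto (fun M => MpEDMD.crossMatrix F ψ (x M) (w M)) atTop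
      (𝓝 (MpEDMD.compressionMatrix K fun j => (hψ j).toLp (ψ j))) :=
    tendsto_pi_nhds.mpr fun j => tendsto_pi_nhds.mpr fun k => hA j k
  have hc0 : c ≠ 0 := by
    rintro rfl
    simp [hc] at hg
  have hν := MpEDMD.eventually_isProbabilityMeasure_spectralMeasure hli hc0 hGH hG' out
  have := MpEDMD.isProbabilityMeasure_scalarSpectralMeasure K hg
  have hbound := MpEDMD.limsup_wassersteinOne_le (μ := MpEDMD.scalarSpectralMeasure K g) hν hL
    fun l hl => by
      rw [MpEDMD.integral_pow_scalarSpectralMeasure]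
      exact MpEDMD.tendsto_integral_pow_spectralMeasure hli hg hc hspan hGH hG' hA' out hl
  -- The limit is the limsup itself, hence the same bound.
  refine ⟨hbound, fun hdet => ⟨_, hbound, ?_⟩⟩
  choose a ha using
    MpEDMD.exists_tendsto_integral_pow_spectralMeasure hli hg hc hGH hG' hA' hdet out
  exact MpEDMD.tendsto_wassersteinOne_of_moments _ hν ha
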